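/- Let $l\ge 2$ and let $(M_1^{m_1},g_1),\dots,(M_l^{m_l},g_l)$ be closed (i.e. compact, without boundary) connected smooth Riemannian manifolds of dimensions $m_1,\dots,m_l\ge 1$, and suppose that $m=m_1+\dots+m_l\ge 3$. Let $M=M_1\times\dots\times M_l$ and $g=g_1\oplus\dots\oplus g_l$. Define the multiconformal class $$[\![g]\!]=\{f_1^2g_1\oplus\dots\oplus f_l^2g_l \mid f_1,\dots,f_l\in C^\infty(M),\ f_i>0\}$$ (each $f_i$ is a function on all of $M$). For a Riemannian metric $\tilde g$ on $M$ with scalar curvature $R^{\tilde g}$ and volume measure $\mu^{\tilde g}$, let $$E(\tilde g)=\frac{\int_M R^{\tilde g}\,d\mu^{\tilde g}}{\left(\int_M d\mu^{\tilde g}\right)^{2/p_m}},\qquad p_m=\frac{2m}{m-2},$$ be the normalized Einstein--Hilbert functional, let $[\tilde g]=\{f^2\tilde g\mid f\in C^\infty(M),\ f>0\}$ be the conformal class of $\tilde g$, and let $\mu(M,[\tilde g])=\inf_{\hat g\in[\tilde g]}E(\hat g)$ be its conformal Yamabe constant. Then $$\inf_{[\tilde g]\subset[\![g]\!]}\mu(M,[\tilde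 g])=\inf_{\tilde g\in[\![g]\!]}E(\tilde g)=-\infty .$$ -/

import Mathlib

open scoped Manifold ContDiff
open MeasureTheory

noncomputable section

/-! ### Products of manifolds -/

/-- A finite product of manifolds is a manifold. -/
instance IsManifold.piInstance {ι : Type*} [Fintype ι]
    {E : ι → Type*} [∀ i, NormedAddCommGroup (E i)] [∀ i, NormedSpace ℝ (E i)]
    {H : ι → Type*} [∀ i, TopologicalSpace (H i)] (I : ∀ i, ModelWithCorners ℝ (E i) (H i))
    (n : ℕ∞ω) (M : ι → Type*) [∀ i, TopologicalSpace (M i)] [∀ i, ChartedSpace (H i) (M i)]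
    [∀ i, IsManifold (I i) n (M i)] :
    IsManifold (ModelWithCorners.pi I) n (∀ i, M i) := by
  apply isManifold_of_contDiffOn
  rintro _ _ ⟨e, he, rfl⟩ ⟨e', he', rfl⟩
  rw [contDiffOn_pi]
  intro i
  have h := (contDiffGroupoid n (I i)).compatible (he i (Set.mem_univ i)) (he' i (Set.mem_univ i))
  rw [contDiffGroupoid, mem_groupoid_of_pregroupoid] at h
  have hf : ContDiffOn ℝ n (fun x : ∀ i, E i ↦ x i)
      ((ModelWithCorners.pi I).symm ⁻¹' ((OpenPartialHomeomorph.pi e).symm.trans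
        (OpenPartialHomeomorph.pi e')).source ∩ Set.range (ModelWithCorners.pi I)) :=
    (contDiff_pi.1 contDiff_id i).contDiffOn
  refine ContDiffOn.comp (g := (I i) ∘ ((e i).symm.trans (e' i)) ∘ (I i).symm) h.1 hf ?_
  rintro x ⟨⟨hx, hx'⟩, y, rfl⟩
  exact ⟨⟨hx i (Set.mem_univ i), hx' i (Set.mem_univ i)⟩, y i, rfl⟩

/-! ### Curvature of a metric in coordinates

Here `G x` is the matrix (as a bilinear form) of a Riemannian metric at the point `x` of a
finite-dimensional coordinate space `E`. -/

section Coordinates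

variable {E : Type*} [NormedAddCommGroup E] [NormedSpace ℝ E]

set_option maxSynthPendingDepth 4 in
/-- Christoffel symbols of the first kind:
`koszulForm G x v w z = (∂_v G(w,z) + ∂_w G(v,z) - ∂_z G(v,w)) / 2`. -/
def koszulForm (G : E → E →L[ℝ] E →L[ℝ] ℝ) (x : E) : E →L[ℝ] E →L[ℝ] E →L[ℝ] ℝ :=
  (1 / 2 : ℝ) • (fderiv ℝ G x + (fderiv ℝ G x).flip -
    (ContinuousLinearMap.flipₗᵢ ℝ E E ℝ).toContinuousLinearEquiv.toContinuousLinearMap ∘L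
      (fderiv ℝ G x).flip)

set_option maxSynthPendingDepth 4 in
theorem koszulForm_apply (G : E → E →L[ℝ] E →L[ℝ] ℝ) (x v w z : E) :
    koszulForm G x v w z =
      (1 / 2) * (fderiv ℝ G x v w z + fderiv ℝ G x w v z - fderiv ℝ G x z v w) := by
  simp [koszulForm]

/-- Christoffel symbols of the second kind: `christoffel G x v w` is the vector `Γ(v,w)` with
`G(Γ(v,w), z) = koszulForm G x v w z` for all `z`, i.e. the Levi-Civita derivative of the constant
field `w` in the direction `v`. -/
def christoffel (G : E → E →L[ℝ] E →L[ℝ] ℝ) (x : E) : E →L[ℝ] E →L[ℝ] E :=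
  (ContinuousLinearMap.compL ℝ E (E →L[ℝ] ℝ) E (G x).inverse) ∘L koszulForm G x

theorem christoffel_apply (G : E → E →L[ℝ] E →L[ℝ] ℝ) (x v w : E) :
    christoffel G x v w = (G x).inverse (koszulForm G x v w) := rfl

/-- The endomorphism `u ↦ R(u,v)w`, with the curvature tensor
`R(u,v)w = ∇_u ∇_v w - ∇_v ∇_u w - ∇_[u,v] w`. -/
def curvatureEndo (G : E → E →L[ℝ] E →L[ℝ] ℝ) (x v w : E) : E →ₗ[ℝ] E where
  toFun u := fderiv ℝ (christoffel G) x u v w - fderiv ℝ (christoffel G) x v u w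
    + christoffel G x u (christoffel G x v w) - christoffel G x v (christoffel G x u w)
  map_add' a b := by simp only [map_add, _root_.add_apply]; abel
  map_smul' c a := by
    simp only [map_smul, _root_.smul_apply, RingHom.id_apply, smul_sub, smul_add]

/-- The Ricci tensor `Ric(v,w) = tr (u ↦ R(u,v)w)`. -/
def ricciForm (G : E → E →L[ℝ] E →L[ℝ] ℝ) (x : E) : E →ₗ[ℝ] E →ₗ[ℝ] ℝ :=
  LinearMap.mk₂ ℝ (fun v w ↦ LinearMap.trace ℝ E (curvatureEndo G x v w))
    (fun a b w ↦ by
      rw [← map_add]; congr 1; ext u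
      simp only [curvatureEndo, map_add, _root_.add_apply, LinearMap.add_apply,
        LinearMap.coe_mk, AddHom.coe_mk]
      abel)
    (fun c v w ↦ by
      rw [← map_smul]; congr 1; ext u
      simp only [curvatureEndo, map_smul, _root_.smul_apply, LinearMap.smul_apply,
        LinearMap.coe_mk, AddHom.coe_mk, smul_sub, smul_add])
    (fun v a b ↦ by
      rw [← map_add]; congr 1; ext u
      simp only [curvatureEndo, map_add, LinearMap.add_apply,
        LinearMap.coe_mk, AddHom.coe_mk]
      abel)
    (fun c v w ↦ by
      rw [← map_smul]; congr 1; ext u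
      simp only [curvatureEndo, map_smul, LinearMap.smul_apply,
        LinearMap.coe_mk, AddHom.coe_mk, smul_sub, smul_add])

/-- The scalar curvature: the trace of the Ricci tensor with respect to `G`, i.e. the trace of the
endomorphism `A` with `G(A v, w) = Ric(v,w)`. -/
def coordScalarCurvature [FiniteDimensional ℝ E] (G : E → E →L[ℝ] E →L[ℝ] ℝ) (x : E) : ℝ :=
  LinearMap.trace ℝ E ((G x).inverse.toLinearMap ∘ₗ
    (LinearMap.toContinuousLinearMap : (E →ₗ[ℝ] ℝ) ≃ₗ[ℝ] (E →L[ℝ] ℝ)).toLinearMap ∘ₗ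
      ricciForm G x)

end Coordinates

/-! ### Riemannian metrics, scalar curvature, volume, the Einstein-Hilbert functional -/

section Manifold

variable {E : Type*} [NormedAddCommGroup E] [NormedSpace ℝ E]
  {H : Type*} [TopologicalSpace H] (I : ModelWithCorners ℝ E H)
  (M : Type*) [TopologicalSpace M] [ChartedSpace H M] [IsManifold I ∞ M]

/-- Smooth Riemannian metrics on the manifold `M`. -/
abbrev SmoothMetric : Type _ :=
  Bundle.ContMDiffRiemannianMetric I ∞ E (TangentSpace I : M → Type _)

variable {I M}

/-- The expression of the metric `h` in the chart at `p`: its pullback, at the point `y` of the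
coordinate space, by the inverse of the chart. -/
def metricInChart (h : SmoothMetric I M) (p : M) (y : E) : E →L[ℝ] E →L[ℝ] ℝ :=
  let A : E →L[ℝ] TangentSpace I ((extChartAt I p).symm y) :=
    mfderiv 𝓘(ℝ, E) I (extChartAt I p).symm y
  (ContinuousLinearMap.precomp ℝ A) ∘L (h.inner ((extChartAt I p).symm y)) ∘L A

/-- The scalar curvature of `h` at `p`, computed in the chart at `p` (manifolds without boundary). -/
def scalarCurvature [FiniteDimensional ℝ E] (h : SmoothMetric I M) (p : M) : ℝ :=
  coordScalarCurvature (metricInChart h p) (extChartAt I p p)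

/-- The measure `√(det G) dy¹⋯dyᵐ` of the chart at `p`, carried to `M`, where `yⁱ` are the
coordinates with respect to a basis of `E` and `G` is the matrix of `h` in this basis. -/
def chartVolume [FiniteDimensional ℝ E] [MeasurableSpace E] [BorelSpace E] [MeasurableSpace M]
    (h : SmoothMetric I M) (p : M) : Measure M :=
  (((Module.finBasis ℝ E).addHaar.restrict (extChartAt I p).target).withDensity
    (fun y ↦ ENNReal.ofReal (Real.sqrt (Matrix.det (Matrix.of fun i j ↦
      metricInChart h p y (Module.finBasis ℝ E i) (Module.finBasis ℝ E j)))))).map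
        (extChartAt I p).symm

/-- The Riemannian volume measure. By the change of variables formula the measures `chartVolume h p`
agree on the overlaps of the charts, so their supremum (the least measure which is bounded below by
all of them) is the measure which restricts to `chartVolume h p` on the domain of each chart. -/
def riemannianVolume [FiniteDimensional ℝ E] [MeasurableSpace E] [BorelSpace E] [MeasurableSpace M]
    (h : SmoothMetric I M) : Measure M :=
  ⨆ p : M, chartVolume h p

/-- The normalized Einstein-Hilbert functional
`(∫ R^h dμ^h) / (∫ dμ^h) ^ (2 / p_m)` with `p_m = 2 m / (m - 2)`, `m = dim M`. -/
def einsteinHilbert [FiniteDimensional ℝ E] [MeasurableSpace E] [BorelSpace E] [MeasurableSpace M]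
    (h : SmoothMetric I M) : ℝ :=
  (∫ x, scalarCurvature h x ∂(riemannianVolume h)) /
    ((riemannianVolume h).real Set.univ) ^
      (2 / (2 * (Module.finrank ℝ E : ℝ) / ((Module.finrank ℝ E : ℝ) - 2)))

/-- The conformal class `[h]`: all metrics `f² h` with `f` smooth and positive. -/
def conformalClass (h : SmoothMetric I M) : Set (SmoothMetric I M) :=
  {h' | ∃ f : M → ℝ, ContMDiff I 𝓘(ℝ, ℝ) ∞ f ∧ (∀ x, 0 < f x) ∧
    ∀ (x : M) (v w : TangentSpace I x), h'.inner x v w = f x ^ 2 * h.inner x v w}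

/-- The conformal Yamabe constant `μ(M, [h])`, the infimum of the normalized Einstein-Hilbert
functional over the conformal class of `h`, as an extended real number. -/
def yamabeConstant [FiniteDimensional ℝ E] [MeasurableSpace E] [BorelSpace E] [MeasurableSpace M]
    (h : SmoothMetric I M) : EReal :=
  ⨅ h' ∈ conformalClass h, (einsteinHilbert h' : EReal)

end Manifold

/-- The multiconformal class `[[g]]` of the product metric `g = g₁ ⊕ ⋯ ⊕ g_l`: all metrics
`f₁² g₁ ⊕ ⋯ ⊕ f_l² g_l` on the product, with `f₁, …, f_l` smooth positive functions on the whole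
product. -/
def multiconformalClass {ι : Type*} [Fintype ι]
    {E : ι → Type*} [∀ i, NormedAddCommGroup (E i)] [∀ i, NormedSpace ℝ (E i)]
    {H : ι → Type*} [∀ i, TopologicalSpace (H i)] {I : ∀ i, ModelWithCorners ℝ (E i) (H i)}
    {M : ι → Type*} [∀ i, TopologicalSpace (M i)] [∀ i, ChartedSpace (H i) (M i)]
    [∀ i, IsManifold (I i) ∞ (M i)]
    (g : ∀ i, SmoothMetric (I i) (M i)) :
    Set (SmoothMetric (ModelWithCorners.pi I) (∀ i, M i)) :=
  {h | ∃ f : ι → (∀ i, M i) → ℝ,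
    (∀ i, ContMDiff (ModelWithCorners.pi I) 𝓘(ℝ, ℝ) ∞ (f i)) ∧ (∀ i x, 0 < f i x) ∧
    ∀ (x : ∀ i, M i) (v w : TangentSpace (ModelWithCorners.pi I) x),
      h.inner x v w = ∑ i, f i x ^ 2 * (g i).inner (x i)
        (mfderiv (ModelWithCorners.pi I) (I i) (fun y : ∀ i, M i ↦ y i) x v)
        (mfderiv (ModelWithCorners.pi I) (I i) (fun y : ∀ i, M i ↦ y i) x w)}

end

noncomputable section

open Filter Topology

section CoordinateCalculus

variable {E : Type*} [NormedAddCommGroup E] [NormedSpace ℝ E]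
  {F : Type*} [NormedAddCommGroup F] [NormedSpace ℝ F]

/-- `G` is a smooth Riemannian metric near the point `x` of a coordinate space. -/
def IsCoordMetric (G : E → E →L[ℝ] E →L[ℝ] ℝ) (x : E) : Prop :=
  ∀ᶠ y in 𝓝 x, ContDiffAt ℝ ∞ G y ∧ (∀ v w, G y v w = G y w v) ∧ ∀ v, v ≠ 0 → 0 < G y v v

/-- `φ` is a smooth local diffeomorphism near `y`. -/
def IsCoordDiffeo (φ : F → E) (y : F) : Prop :=
  ∀ᶠ z in 𝓝 y, ContDiffAt ℝ ∞ φ z ∧ (fderiv ℝ φ z).IsInvertible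

variable {G : E → E →L[ℝ] E →L[ℝ] ℝ} {x : E}

namespace IsCoordMetric

theorem eventually (hG : IsCoordMetric G x) : ∀ᶠ y in 𝓝 x, IsCoordMetric G y :=
  eventually_eventually_nhds.2 hG

theorem smooth (hG : IsCoordMetric G x) : ContDiffAt ℝ ∞ G x := hG.self_of_nhds.1

theorem symm (hG : IsCoordMetric G x) (v w : E) : G x v w = G x w v := hG.self_of_nhds.2.1 v w

theorem pos (hG : IsCoordMetric G x) {v : E} (hv : v ≠ 0) : 0 < G x v v :=
  hG.self_of_nhds.2.2 v hv

theorem differentiableAt (hG : IsCoordMetric G x) : DifferentiableAt ℝ G x :=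
  hG.smooth.differentiableAt (by simp)

theorem injective (hG : IsCoordMetric G x) : Function.Injective (G x) := by
  refine (injective_iff_map_eq_zero _).2 fun v hv ↦ ?_
  by_contra h
  have := hG.pos h
  simp [hv] at this

theorem isInvertible [FiniteDimensional ℝ E] (hG : IsCoordMetric G x) :
    (G x).IsInvertible := by
  have hd : Module.finrank ℝ E = Module.finrank ℝ (E →L[ℝ] ℝ) := by
    rw [← (LinearMap.toContinuousLinearMap : (E →ₗ[ℝ] ℝ) ≃ₗ[ℝ] (E →L[ℝ] ℝ)).finrank_eq]
    exact (Subspace.dual_finrank_eq (K := ℝ) (V := E)).symm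
  refine ⟨(LinearEquiv.ofInjectiveOfFinrankEq (G x).toLinearMap hG.injective
    hd).toContinuousLinearEquiv, ?_⟩
  ext v w
  rfl

theorem apply_christoffel [FiniteDimensional ℝ E] (hG : IsCoordMetric G x) (v w z : E) :
    G x (christoffel G x v w) z = koszulForm G x v w z := by
  rw [christoffel_apply, hG.isInvertible.self_apply_inverse]

theorem eq_of_apply_eq (hG : IsCoordMetric G x) {v w : E} (h : ∀ z, G x v z = G x w z) :
    v = w := hG.injective (ContinuousLinearMap.ext h)

theorem fderiv_apply_symm (hG : IsCoordMetric G x) (u v w : E) :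
    fderiv ℝ G x u v w = fderiv ℝ G x u w v := by
  have h1 : HasFDerivAt (fun y ↦ G y v w) _ x :=
    (hG.differentiableAt.hasFDerivAt.clm_apply (hasFDerivAt_const v x)).clm_apply
      (hasFDerivAt_const w x)
  have h2 : HasFDerivAt (fun y ↦ G y w v) _ x :=
    (hG.differentiableAt.hasFDerivAt.clm_apply (hasFDerivAt_const w x)).clm_apply
      (hasFDerivAt_const v x)
  have h3 : (fun y ↦ G y v w) =ᶠ[𝓝 x] fun y ↦ G y w v := by
    filter_upwards [hG] with y hy using hy.2.1 v w
  have := congrArg (fun A : E →L[ℝ] ℝ ↦ A u) ((h1.congr_of_eventuallyEq h3.symm).unique h2)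
  simpa using this

theorem koszulForm_symm (hG : IsCoordMetric G x) (v w z : E) :
    koszulForm G x v w z = koszulForm G x w v z := by
  rw [koszulForm_apply, koszulForm_apply, hG.fderiv_apply_symm z v w]
  ring

theorem christoffel_symm (hG : IsCoordMetric G x) (v w : E) :
    christoffel G x v w = christoffel G x w v := by
  rw [christoffel_apply, christoffel_apply]
  congr 1
  ext z
  exact hG.koszulForm_symm v w z

end IsCoordMetric

set_option maxSynthPendingDepth 4 in
theorem ContDiffAt.koszulForm (hG : ContDiffAt ℝ ∞ G x) : ContDiffAt ℝ ∞ (koszulForm G) x := by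
  have h : ContDiffAt ℝ ∞ (fderiv ℝ G) x := hG.fderiv_right (by simp)
  have hf : ContDiffAt ℝ ∞ (fun y ↦ (fderiv ℝ G y).flip) x :=
    (ContinuousLinearMap.flipₗᵢ ℝ E E (E →L[ℝ] ℝ)).toContinuousLinearEquiv.contDiff.contDiffAt.comp
      x h
  exact ((h.add hf).sub (contDiffAt_const.clm_comp hf)).const_smul _

theorem IsCoordMetric.contDiffAt_inverse [FiniteDimensional ℝ E] (hG : IsCoordMetric G x) :
    ContDiffAt ℝ ∞ (fun y ↦ (G y).inverse) x := by
  have := FiniteDimensional.complete ℝ E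
  exact ContDiffAt.comp x (hG.isInvertible.contDiffAt_map_inverse) hG.smooth

set_option maxSynthPendingDepth 4 in
theorem IsCoordMetric.contDiffAt_christoffel [FiniteDimensional ℝ E] (hG : IsCoordMetric G x) :
    ContDiffAt ℝ ∞ (christoffel G) x := by
  refine ContDiffAt.clm_comp ?_ hG.smooth.koszulForm
  exact (ContinuousLinearMap.contDiff _).contDiffAt.comp x hG.contDiffAt_inverse

theorem HasFDerivAt.clm_apply_const₂ {H : Type*} [NormedAddCommGroup H] [NormedSpace ℝ H]
    {F' : Type*} [NormedAddCommGroup F'] [NormedSpace ℝ F']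
    {B : E → F →L[ℝ] F' →L[ℝ] H} {B' : E →L[ℝ] F →L[ℝ] F' →L[ℝ] H} (h : HasFDerivAt B B' x)
    (v : F) (w : F') : HasFDerivAt (fun y ↦ B y v w) ((B'.flip v).flip w) x := by
  convert (h.clm_apply (hasFDerivAt_const v x)).clm_apply (hasFDerivAt_const w x) using 1
  ext u
  simp

theorem fderiv_clm_apply_const₂ {H : Type*} [NormedAddCommGroup H] [NormedSpace ℝ H]
    {F' : Type*} [NormedAddCommGroup F'] [NormedSpace ℝ F']
    {B : E → F →L[ℝ] F' →L[ℝ] H} (h : DifferentiableAt ℝ B x)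
    (u : E) (v : F) (w : F') : fderiv ℝ (fun y ↦ B y v w) x u = fderiv ℝ B x u v w := by
  rw [(h.hasFDerivAt.clm_apply_const₂ v w).fderiv]
  simp

section Invariance

variable {φ : F → E} {y : F} {G' : F → F →L[ℝ] F →L[ℝ] ℝ}

theorem IsCoordDiffeo.eventually (hφ : IsCoordDiffeo φ y) : ∀ᶠ z in 𝓝 y, IsCoordDiffeo φ z :=
  eventually_eventually_nhds.2 hφ

theorem IsCoordDiffeo.smooth (hφ : IsCoordDiffeo φ y) : ContDiffAt ℝ ∞ φ y := hφ.self_of_nhds.1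

theorem IsCoordDiffeo.isInvertible (hφ : IsCoordDiffeo φ y) : (fderiv ℝ φ y).IsInvertible :=
  hφ.self_of_nhds.2

theorem IsCoordDiffeo.differentiableAt (hφ : IsCoordDiffeo φ y) : DifferentiableAt ℝ φ y :=
  hφ.smooth.differentiableAt (by simp)

theorem IsCoordDiffeo.contDiffAt_fderiv (hφ : IsCoordDiffeo φ y) :
    ContDiffAt ℝ ∞ (fderiv ℝ φ) y := hφ.smooth.fderiv_right (by simp)

theorem IsCoordDiffeo.hasFDerivAt_fderiv_apply (hφ : IsCoordDiffeo φ y) (v : F) :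
    HasFDerivAt (fun z ↦ fderiv ℝ φ z v) ((fderiv ℝ (fderiv ℝ φ) y).flip v) y := by
  convert ((hφ.contDiffAt_fderiv.differentiableAt (by simp)).hasFDerivAt.clm_apply
    (hasFDerivAt_const v y)) using 1
  ext u
  simp

theorem IsCoordDiffeo.fderiv_fderiv_symm (hφ : IsCoordDiffeo φ y) (v w : F) :
    fderiv ℝ (fderiv ℝ φ) y v w = fderiv ℝ (fderiv ℝ φ) y w v :=
  (hφ.smooth.isSymmSndFDerivAt (by simpa using ENat.LEInfty.out)).eq v w

/-- `G'` is the pullback of `G` by `φ` near `y`. -/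
def IsPullbackAt (φ : F → E) (G : E → E →L[ℝ] E →L[ℝ] ℝ) (G' : F → F →L[ℝ] F →L[ℝ] ℝ) (y : F) :
    Prop :=
  ∀ᶠ z in 𝓝 y, ∀ v w, G' z v w = G (φ z) (fderiv ℝ φ z v) (fderiv ℝ φ z w)

theorem IsPullbackAt.eventually (h : IsPullbackAt φ G G' y) :
    ∀ᶠ z in 𝓝 y, IsPullbackAt φ G G' z := eventually_eventually_nhds.2 h

theorem IsPullbackAt.isCoordMetric (h : IsPullbackAt φ G G' y) (hφ : IsCoordDiffeo φ y)
    (hG : IsCoordMetric G (φ y)) : IsCoordMetric G' y := by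
  have h1 := hφ.differentiableAt.continuousAt.eventually hG
  filter_upwards [h.eventually, hφ.eventually, h1] with z hz hz' hz1
  refine ⟨?_, fun v w ↦ ?_, fun v hv ↦ ?_⟩
  · have h2 : ContDiffAt ℝ ∞ (fun z ↦ (ContinuousLinearMap.compL ℝ F E ℝ).flip (fderiv ℝ φ z) ∘L
        (G (φ z)) ∘L (fderiv ℝ φ z)) z := by
      refine ContDiffAt.clm_comp ?_ (ContDiffAt.clm_comp ?_ hz'.contDiffAt_fderiv)
      · exact (ContinuousLinearMap.contDiff _).contDiffAt.comp z hz'.contDiffAt_fderiv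
      · exact ContDiffAt.comp z hz1.1 hz'.smooth
    refine h2.congr_of_eventuallyEq ?_
    filter_upwards [hz] with t ht
    ext v w
    simp [ht v w]
  · rw [hz.self_of_nhds, hz.self_of_nhds, hz1.2.1]
  · rw [hz.self_of_nhds]
    exact hz1.2.2 _ fun h0 ↦ hv (hz'.isInvertible.injective (by simpa using h0))

set_option maxSynthPendingDepth 4 in
theorem IsPullbackAt.fderiv_apply (h : IsPullbackAt φ G G' y) (hφ : IsCoordDiffeo φ y)
    (hG : IsCoordMetric G (φ y)) (u v w : F) :
    fderiv ℝ G' y u v w = fderiv ℝ G (φ y) (fderiv ℝ φ y u) (fderiv ℝ φ y v) (fderiv ℝ φ y w)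
      + G (φ y) (fderiv ℝ (fderiv ℝ φ) y u v) (fderiv ℝ φ y w)
      + G (φ y) (fderiv ℝ φ y v) (fderiv ℝ (fderiv ℝ φ) y u w) := by
  have hG' := h.isCoordMetric hφ hG
  rw [← fderiv_clm_apply_const₂ hG'.differentiableAt]
  have h1 : (fun z ↦ G' z v w) =ᶠ[𝓝 y] fun z ↦ G (φ z) (fderiv ℝ φ z v) (fderiv ℝ φ z w) := by
    filter_upwards [h] with z hz using hz v w
  rw [h1.fderiv_eq]
  have h2 : HasFDerivAt (fun z ↦ G (φ z)) ((fderiv ℝ G (φ y)).comp (fderiv ℝ φ y)) y :=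
    hG.differentiableAt.hasFDerivAt.comp y hφ.differentiableAt.hasFDerivAt
  have h3 := (h2.clm_apply (hφ.hasFDerivAt_fderiv_apply v)).clm_apply
    (hφ.hasFDerivAt_fderiv_apply w)
  rw [h3.fderiv]
  simp
  ring

theorem IsPullbackAt.koszulForm_apply (h : IsPullbackAt φ G G' y) (hφ : IsCoordDiffeo φ y)
    (hG : IsCoordMetric G (φ y)) (v w z : F) :
    koszulForm G' y v w z = koszulForm G (φ y) (fderiv ℝ φ y v) (fderiv ℝ φ y w) (fderiv ℝ φ y z)
      + G (φ y) (fderiv ℝ (fderiv ℝ φ) y v w) (fderiv ℝ φ y z) := by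
  rw [_root_.koszulForm_apply, _root_.koszulForm_apply, h.fderiv_apply hφ hG, h.fderiv_apply hφ hG,
    h.fderiv_apply hφ hG, hφ.fderiv_fderiv_symm w v, hφ.fderiv_fderiv_symm z v,
    hφ.fderiv_fderiv_symm z w, hG.symm (fderiv ℝ φ y w) (fderiv ℝ (fderiv ℝ φ) y v z)]
  ring

variable [FiniteDimensional ℝ E] [FiniteDimensional ℝ F]

theorem IsPullbackAt.christoffel_apply (h : IsPullbackAt φ G G' y) (hφ : IsCoordDiffeo φ y)
    (hG : IsCoordMetric G (φ y)) (v w : F) :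
    fderiv ℝ φ y (christoffel G' y v w) =
      christoffel G (φ y) (fderiv ℝ φ y v) (fderiv ℝ φ y w) + fderiv ℝ (fderiv ℝ φ) y v w := by
  refine hG.eq_of_apply_eq fun z ↦ ?_
  obtain ⟨z, rfl⟩ := hφ.isInvertible.surjective z
  rw [← h.self_of_nhds, (h.isCoordMetric hφ hG).apply_christoffel, map_add, _root_.add_apply,
    hG.apply_christoffel, h.koszulForm_apply hφ hG]

theorem IsPullbackAt.curvatureEndo_apply (h : IsPullbackAt φ G G' y) (hφ : IsCoordDiffeo φ y)
    (hG : IsCoordMetric G (φ y)) (u v w : F) :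
    fderiv ℝ φ y (curvatureEndo G' y v w u) =
      curvatureEndo G (φ y) (fderiv ℝ φ y v) (fderiv ℝ φ y w) (fderiv ℝ φ y u) := by
  have hG' := h.isCoordMetric hφ hG
  have hd (a b w : F) : fderiv ℝ φ y (fderiv ℝ (christoffel G') y a b w)
      + fderiv ℝ (fderiv ℝ φ) y a (christoffel G' y b w) =
      fderiv ℝ (christoffel G) (φ y) (fderiv ℝ φ y a) (fderiv ℝ φ y b) (fderiv ℝ φ y w)
      + christoffel G (φ y) (fderiv ℝ (fderiv ℝ φ) y a b) (fderiv ℝ φ y w)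
      + christoffel G (φ y) (fderiv ℝ φ y b) (fderiv ℝ (fderiv ℝ φ) y a w)
      + fderiv ℝ (fderiv ℝ (fderiv ℝ φ)) y a b w := by
    have e : (fun z ↦ fderiv ℝ φ z (christoffel G' z b w)) =ᶠ[𝓝 y] fun z ↦
        christoffel G (φ z) (fderiv ℝ φ z b) (fderiv ℝ φ z w) + fderiv ℝ (fderiv ℝ φ) z b w := by
      filter_upwards [h.eventually, hφ.eventually,
        hφ.differentiableAt.continuousAt.eventually hG.eventually] with z h1 h2 h3
      exact h1.christoffel_apply h2 h3 b w
    have l := (hφ.contDiffAt_fderiv.differentiableAt (by simp)).hasFDerivAt.clm_apply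
      ((hG'.contDiffAt_christoffel.differentiableAt (by simp)).hasFDerivAt.clm_apply_const₂ b w)
    have r1 : HasFDerivAt (fun z ↦ christoffel G (φ z)) _ y :=
      (hG.contDiffAt_christoffel.differentiableAt (by simp)).hasFDerivAt.comp y
        hφ.differentiableAt.hasFDerivAt
    have r2 : HasFDerivAt (fun z ↦ fderiv ℝ (fderiv ℝ φ) z b w) _ y :=
      ((hφ.contDiffAt_fderiv.fderiv_right (m := ∞) (by simp)).differentiableAt
        (by simp)).hasFDerivAt.clm_apply_const₂ b w
    have r := ((r1.clm_apply (hφ.hasFDerivAt_fderiv_apply b)).clm_apply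
      (hφ.hasFDerivAt_fderiv_apply w)).add r2
    have := congrArg (fun A : F →L[ℝ] E ↦ A a) (l.unique (r.congr_of_eventuallyEq e))
    simp at this
    rw [this]
    abel
  have h3 : fderiv ℝ (fderiv ℝ (fderiv ℝ φ)) y u v w = fderiv ℝ (fderiv ℝ (fderiv ℝ φ)) y v u w :=
    congrArg (fun A : F →L[ℝ] E ↦ A w)
      ((hφ.contDiffAt_fderiv.isSymmSndFDerivAt (by simpa using ENat.LEInfty.out)).eq u v)
  have e1 := hd u v w
  have e2 := hd v u w
  rw [← eq_sub_iff_add_eq] at e1 e2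
  simp only [curvatureEndo, LinearMap.coe_mk, AddHom.coe_mk, map_sub, map_add, e1, e2,
    h.christoffel_apply hφ hG, h3, hφ.fderiv_fderiv_symm v u]
  abel

theorem IsPullbackAt.ricciForm_apply (h : IsPullbackAt φ G G' y) (hφ : IsCoordDiffeo φ y)
    (hG : IsCoordMetric G (φ y)) (v w : F) :
    ricciForm G' y v w = ricciForm G (φ y) (fderiv ℝ φ y v) (fderiv ℝ φ y w) := by
  obtain ⟨e, he⟩ := hφ.isInvertible
  change LinearMap.trace ℝ F _ = LinearMap.trace ℝ E _
  rw [← LinearMap.trace_conj' _ e.toLinearEquiv]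
  congr 1
  ext u
  obtain ⟨u, rfl⟩ := e.surjective u
  have h1 := h.curvatureEndo_apply hφ hG u v w
  rw [← he] at h1 ⊢
  simpa [LinearEquiv.conj_apply] using h1

/-- The scalar curvature is invariant under changes of coordinates. -/
theorem IsPullbackAt.coordScalarCurvature_eq (h : IsPullbackAt φ G G' y) (hφ : IsCoordDiffeo φ y)
    (hG : IsCoordMetric G (φ y)) :
    coordScalarCurvature G' y = coordScalarCurvature G (φ y) := by
  obtain ⟨e, he⟩ := hφ.isInvertible
  unfold coordScalarCurvature
  rw [← LinearMap.trace_conj' _ e.toLinearEquiv]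
  congr 1
  ext v
  obtain ⟨v, rfl⟩ := e.surjective v
  refine hG.eq_of_apply_eq fun w ↦ ?_
  obtain ⟨w, rfl⟩ := e.surjective w
  have h1 := h.ricciForm_apply hφ hG v w
  have h2 := fun a ↦ h.self_of_nhds a w
  rw [← he] at h1 h2
  simp only [ContinuousLinearEquiv.coe_coe] at h1 h2
  simp only [LinearEquiv.conj_apply, LinearMap.comp_apply, LinearEquiv.coe_coe,
    ContinuousLinearEquiv.coe_toLinearEquiv, ContinuousLinearMap.coe_coe, ← h2,
    hG.isInvertible.self_apply_inverse, (h.isCoordMetric hφ hG).isInvertible.self_apply_inverse]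
  simpa using h1

end Invariance

end CoordinateCalculus

section OrthonormalFrame

set_option maxSynthPendingDepth 4

variable {E : Type*} [NormedAddCommGroup E] [NormedSpace ℝ E]
  {G : E → E →L[ℝ] E →L[ℝ] ℝ} {x : E}

theorem LinearMap.trace_eq_sum_repr {κ : Type*} [Fintype κ] [DecidableEq κ]
    {V : Type*} [AddCommGroup V] [Module ℝ V]
    (e : Module.Basis κ ℝ V) (f : V →ₗ[ℝ] V) : LinearMap.trace ℝ V f = ∑ a, e.repr (f (e a)) a := by
  rw [LinearMap.trace_eq_matrix_trace ℝ e f, Matrix.trace]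
  simp [LinearMap.toMatrix_apply]

theorem ricciForm_eq_sum {κ : Type*} [Fintype κ] [DecidableEq κ]
    (e : Module.Basis κ ℝ E) (v w : E) :
    ricciForm G x v w = ∑ a, e.repr (curvatureEndo G x v w (e a)) a := by
  rw [← LinearMap.trace_eq_sum_repr e]
  rfl

theorem IsCoordMetric.differentiableAt_fderiv (hG : IsCoordMetric G x) :
    DifferentiableAt ℝ (fderiv ℝ G) x :=
  (hG.smooth.fderiv_right (m := ∞) (by simp)).differentiableAt (by simp)

theorem IsCoordMetric.hasFDerivAt_fderiv_apply (hG : IsCoordMetric G x) (v w z : E) :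
    HasFDerivAt (fun y ↦ fderiv ℝ G y v w z)
      ((((fderiv ℝ (fderiv ℝ G) x).flip v).flip w).flip z) x := by
  have h := (hG.differentiableAt_fderiv.hasFDerivAt.clm_apply_const₂ v w).clm_apply
    (hasFDerivAt_const z x)
  exact h.congr_fderiv (by ext u; simp)

theorem IsCoordMetric.fderiv_koszulForm_apply (hG : IsCoordMetric G x) (u v w z : E) :
    fderiv ℝ (koszulForm G) x u v w z = (1 / 2) * (fderiv ℝ (fderiv ℝ G) x u v w z +
      fderiv ℝ (fderiv ℝ G) x u w v z - fderiv ℝ (fderiv ℝ G) x u z v w) := by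
  have h1 := ((hG.smooth.koszulForm.differentiableAt (by simp)).hasFDerivAt.clm_apply_const₂
    v w).clm_apply (hasFDerivAt_const z x)
  have h2 := (((hG.hasFDerivAt_fderiv_apply v w z).add (hG.hasFDerivAt_fderiv_apply w v z)).sub
    (hG.hasFDerivAt_fderiv_apply z v w)).const_mul (1 / 2)
  have h3 : (fun y ↦ koszulForm G y v w z) =
      fun y ↦ 1 / 2 * (fderiv ℝ G y v w z + fderiv ℝ G y w v z - fderiv ℝ G y z v w) := by
    ext y
    exact koszulForm_apply G y v w z
  rw [h3] at h1
  have := congrArg (fun A : E →L[ℝ] ℝ ↦ A u) (h1.unique h2)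
  simpa using this

theorem IsCoordMetric.fderiv_fderiv_apply_symm (hG : IsCoordMetric G x) (u v w z : E) :
    fderiv ℝ (fderiv ℝ G) x u v w z = fderiv ℝ (fderiv ℝ G) x u v z w := by
  have h : (fun y ↦ fderiv ℝ G y v w z) =ᶠ[𝓝 x] fun y ↦ fderiv ℝ G y v z w := by
    filter_upwards [hG.eventually] with y hy using hy.fderiv_apply_symm v w z
  have := ((hG.hasFDerivAt_fderiv_apply v w z).congr_of_eventuallyEq h.symm).unique
    (hG.hasFDerivAt_fderiv_apply v z w)
  simpa using congrArg (fun A : E →L[ℝ] ℝ ↦ A u) this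

variable [FiniteDimensional ℝ E]

theorem coordScalarCurvature_eq_sum {κ : Type*} [Fintype κ] [DecidableEq κ]
    (e : Module.Basis κ ℝ E) : coordScalarCurvature G x = ∑ a, e.repr ((G x).inverse
      (LinearMap.toContinuousLinearMap (ricciForm G x (e a)))) a := by
  rw [coordScalarCurvature, LinearMap.trace_eq_sum_repr e]
  rfl

theorem IsCoordMetric.continuousAt_coordScalarCurvature (hG : IsCoordMetric G x) :
    ContinuousAt (coordScalarCurvature G) x := by
  let e := Module.finBasis ℝ E
  have hr (a) : Continuous fun v : E ↦ e.repr v a :=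
    (LinearMap.continuous_of_finiteDimensional (e.coord a))
  have hΓ := hG.contDiffAt_christoffel
  have h1 : ContinuousAt (fun y ↦ christoffel G y) x := hΓ.continuousAt
  have h2 : ContinuousAt (fun y ↦ fderiv ℝ (christoffel G) y) x :=
    (hΓ.fderiv_right (m := 0) (by simp)).continuousAt
  have hR (v w : E) : ContinuousAt (fun y ↦ ricciForm G y v w) x := by
    simp_rw [ricciForm_eq_sum e]
    refine tendsto_finsetSum _ fun a _ ↦ (hr a).continuousAt.comp ?_
    simp only [curvatureEndo, LinearMap.coe_mk, AddHom.coe_mk]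
    fun_prop
  have hRic (v : E) : ContinuousAt (fun y ↦ LinearMap.toContinuousLinearMap (ricciForm G y v)) x := by
    rw [continuousAt_clm_apply]
    intro w
    exact hR v w
  have hinv := hG.contDiffAt_inverse.continuousAt
  have : coordScalarCurvature G = fun y ↦ ∑ a, e.repr ((G y).inverse
      (LinearMap.toContinuousLinearMap (ricciForm G y (e a)))) a := by
    ext y
    exact coordScalarCurvature_eq_sum e
  rw [this]
  refine tendsto_finsetSum _ fun a _ ↦ (hr a).continuousAt.comp ?_
  exact hinv.clm_apply (hRic _)

theorem IsCoordMetric.apply_fderiv_christoffel (hG : IsCoordMetric G x) (u v w z : E) :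
    G x (fderiv ℝ (christoffel G) x u v w) z =
      fderiv ℝ (koszulForm G) x u v w z - fderiv ℝ G x u (christoffel G x v w) z := by
  have h : (fun y ↦ G y (christoffel G y v w) z) =ᶠ[𝓝 x] fun y ↦ koszulForm G y v w z := by
    filter_upwards [hG.eventually] with y hy using hy.apply_christoffel v w z
  have h1 := (hG.differentiableAt.hasFDerivAt.clm_apply
    ((hG.contDiffAt_christoffel.differentiableAt (by simp)).hasFDerivAt.clm_apply_const₂
      v w)).clm_apply (hasFDerivAt_const z x)
  have h2 := ((hG.smooth.koszulForm.differentiableAt (by simp)).hasFDerivAt.clm_apply_const₂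
    v w).clm_apply (hasFDerivAt_const z x)
  have := congrArg (fun A : E →L[ℝ] ℝ ↦ A u) ((h1.congr_of_eventuallyEq h.symm).unique h2)
  simp at this
  linarith

/-- The sectional curvature form in terms of the second derivatives of the metric. -/
theorem IsCoordMetric.apply_curvatureEndo (hG : IsCoordMetric G x) (u v : E) :
    G x (curvatureEndo G x v v u) u = fderiv ℝ (fderiv ℝ G) x u v v u
      - (1 / 2) * fderiv ℝ (fderiv ℝ G) x u u v v - (1 / 2) * fderiv ℝ (fderiv ℝ G) x v v u u
      + G x (christoffel G x u v) (christoffel G x u v)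
      - G x (christoffel G x u u) (christoffel G x v v) := by
  simp only [curvatureEndo, LinearMap.coe_mk, AddHom.coe_mk, map_sub, map_add, _root_.sub_apply,
    _root_.add_apply, hG.apply_fderiv_christoffel, hG.apply_christoffel,
    hG.fderiv_koszulForm_apply]
  rw [hG.christoffel_symm u v]
  simp only [koszulForm_apply]
  have e1 := hG.fderiv_fderiv_apply_symm v v u u
  rw [hG.fderiv_fderiv_apply_symm v u v u, hG.fderiv_apply_symm u (christoffel G x v v) u,
    hG.fderiv_apply_symm v (christoffel G x v u) u,
    hG.fderiv_apply_symm (christoffel G x v u) u v]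
  ring

/-- The scalar curvature in a frame which is orthonormal at the given point. -/
theorem IsCoordMetric.coordScalarCurvature_eq_sum {κ : Type*} [Fintype κ] [DecidableEq κ]
    (hG : IsCoordMetric G x) (e : Module.Basis κ ℝ E)
    (he : ∀ a b, G x (e a) (e b) = if a = b then 1 else 0) :
    coordScalarCurvature G x = ∑ a, ∑ b, (fderiv ℝ (fderiv ℝ G) x (e a) (e b) (e b) (e a)
      - (1 / 2) * fderiv ℝ (fderiv ℝ G) x (e a) (e a) (e b) (e b)
      - (1 / 2) * fderiv ℝ (fderiv ℝ G) x (e b) (e b) (e a) (e a)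
      + ∑ c, koszulForm G x (e a) (e b) (e c) ^ 2
      - ∑ c, koszulForm G x (e a) (e a) (e c) * koszulForm G x (e b) (e b) (e c)) := by
  have hr (v : E) (a : κ) : e.repr v a = G x v (e a) := by
    conv_rhs => rw [← e.sum_repr v]
    simp only [map_sum, _root_.sum_apply, map_smul, _root_.smul_apply, he]
    simp
  have hs (v w : E) : G x v w = ∑ c, G x v (e c) * G x w (e c) := by
    conv_lhs => rw [← e.sum_repr w]
    simp only [map_sum, map_smul, smul_eq_mul, hr]
    exact Finset.sum_congr rfl fun c _ ↦ mul_comm _ _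
  rw [_root_.coordScalarCurvature_eq_sum e, Finset.sum_comm]
  refine Finset.sum_congr rfl fun b _ ↦ ?_
  rw [hr, hG.isInvertible.self_apply_inverse, LinearMap.coe_toContinuousLinearMap',
    ricciForm_eq_sum e]
  refine Finset.sum_congr rfl fun a _ ↦ ?_
  rw [hr, hG.apply_curvatureEndo, hs (christoffel G x (e a) (e b)),
    hs (christoffel G x (e a) (e a))]
  simp only [hG.apply_christoffel, sq]

theorem exists_orthonormal_basis {A : E →L[ℝ] E →L[ℝ] ℝ} (hs : ∀ v w, A v w = A w v)
    (hp : ∀ v, v ≠ 0 → 0 < A v v) :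
    ∃ b : Module.Basis (Fin (Module.finrank ℝ E)) ℝ E,
      ∀ i j, A (b i) (b j) = if i = j then 1 else 0 := by
  let B : LinearMap.BilinForm ℝ E := LinearMap.mk₂ ℝ (fun v w ↦ A v w) (by simp) (by simp)
    (by simp) (by simp)
  have : Invertible (2 : ℝ) := invertibleTwo
  obtain ⟨v, hv⟩ := LinearMap.BilinForm.exists_orthogonal_basis (B := B) ⟨hs⟩
  have hpos (i) : 0 < A (v i) (v i) := hp _ (v.ne_zero i)
  have hu (i) : IsUnit (Real.sqrt (A (v i) (v i)))⁻¹ :=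
    (isUnit_iff_ne_zero.2 (inv_ne_zero (Real.sqrt_ne_zero'.2 (hpos i))))
  refine ⟨v.isUnitSMul hu, fun i j ↦ ?_⟩
  simp only [Module.Basis.isUnitSMul_apply, map_smul, _root_.smul_apply, smul_eq_mul]
  split_ifs with h
  · subst h
    have := Real.sq_sqrt (hpos i).le
    have h0 := Real.sqrt_ne_zero'.2 (hpos i)
    field_simp
    linarith
  · have : A (v i) (v j) = 0 := hv h
    simp [this]

end OrthonormalFrame

section NormalCoordinates

set_option maxSynthPendingDepth 4

variable {E : Type*} [NormedAddCommGroup E] [NormedSpace ℝ E]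
  {G : E → E →L[ℝ] E →L[ℝ] ℝ} {x : E}

/-- The pullback of a family of bilinear forms. -/
def pullbackForm {F : Type*} [NormedAddCommGroup F] [NormedSpace ℝ F]
    (φ : F → E) (G : E → E →L[ℝ] E →L[ℝ] ℝ) (y : F) : F →L[ℝ] F →L[ℝ] ℝ :=
  (ContinuousLinearMap.precomp ℝ (fderiv ℝ φ y)) ∘L (G (φ y)) ∘L (fderiv ℝ φ y)

theorem pullbackForm_apply {F : Type*} [NormedAddCommGroup F] [NormedSpace ℝ F]
    (φ : F → E) (G : E → E →L[ℝ] E →L[ℝ] ℝ) (y : F) (v w : F) :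
    pullbackForm φ G y v w = G (φ y) (fderiv ℝ φ y v) (fderiv ℝ φ y w) := rfl

theorem isPullbackAt_pullbackForm {F : Type*} [NormedAddCommGroup F] [NormedSpace ℝ F]
    (φ : F → E) (G : E → E →L[ℝ] E →L[ℝ] ℝ) (y : F) : IsPullbackAt φ G (pullbackForm φ G) y :=
  Eventually.of_forall fun _ _ _ ↦ rfl

theorem isCoordDiffeo_of_contDiff {F : Type*} [NormedAddCommGroup F] [NormedSpace ℝ F]
    [CompleteSpace F] {φ : F → E} (hφ : ContDiff ℝ ∞ φ) {y : F}
    (h : (fderiv ℝ φ y).IsInvertible) : IsCoordDiffeo φ y := by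
  obtain ⟨e, he⟩ := h
  have h1 : ∀ᶠ A : F →L[ℝ] E in 𝓝 (fderiv ℝ φ y), A.IsInvertible := by
    rw [← he]
    exact ContinuousLinearEquiv.nhds e
  have h2 : ContinuousAt (fderiv ℝ φ) y := (hφ.continuous_fderiv (by simp)).continuousAt
  filter_upwards [h2.eventually h1] with z hz using ⟨hφ.contDiffAt, hz⟩

/-- A change of coordinates after which the first derivatives of the metric `G` vanish at `x`. -/
def normalChange (G : E → E →L[ℝ] E →L[ℝ] ℝ) (x z : E) : E :=
  z - (1 / 2 : ℝ) • christoffel G x (z - x) (z - x)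

@[simp]
theorem normalChange_self (G : E → E →L[ℝ] E →L[ℝ] ℝ) (x : E) : normalChange G x x = x := by
  simp [normalChange]

theorem contDiff_normalChange (G : E → E →L[ℝ] E →L[ℝ] ℝ) (x : E) :
    ContDiff ℝ ∞ (normalChange G x) := by
  unfold normalChange
  fun_prop

theorem fderiv_normalChange_apply (G : E → E →L[ℝ] E →L[ℝ] ℝ) (x z v : E) :
    fderiv ℝ (normalChange G x) z v =
      v - (1 / 2 : ℝ) • (christoffel G x v (z - x) + christoffel G x (z - x) v) := by
  have h0 : HasFDerivAt (fun z ↦ z - x) (ContinuousLinearMap.id ℝ E) z :=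
    (hasFDerivAt_id z).sub_const x
  have h := (hasFDerivAt_id z).sub (((((christoffel G x).hasFDerivAt.comp z h0)).clm_apply
    h0).const_smul (1 / 2 : ℝ))
  have h2 : HasFDerivAt (normalChange G x) _ z := h
  rw [h2.fderiv]
  simp [add_comm]

theorem fderiv_normalChange_self (G : E → E →L[ℝ] E →L[ℝ] ℝ) (x : E) :
    fderiv ℝ (normalChange G x) x = ContinuousLinearMap.id ℝ E := by
  ext v
  simp [fderiv_normalChange_apply]

variable [FiniteDimensional ℝ E]

theorem isCoordDiffeo_normalChange (G : E → E →L[ℝ] E →L[ℝ] ℝ) (x : E) :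
    IsCoordDiffeo (normalChange G x) x := by
  have := FiniteDimensional.complete ℝ E
  refine isCoordDiffeo_of_contDiff (contDiff_normalChange G x) ?_
  rw [fderiv_normalChange_self]
  exact ⟨ContinuousLinearEquiv.refl ℝ E, rfl⟩

theorem IsCoordMetric.fderiv_fderiv_normalChange (hG : IsCoordMetric G x) (v w : E) :
    fderiv ℝ (fderiv ℝ (normalChange G x)) x v w = - christoffel G x v w := by
  have h := (isCoordDiffeo_normalChange G x).hasFDerivAt_fderiv_apply w
  have h0 : HasFDerivAt (fun z ↦ z - x) (ContinuousLinearMap.id ℝ E) x :=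
    (hasFDerivAt_id x).sub_const x
  have h1 := ((((christoffel G x w).hasFDerivAt.comp x h0).add
    (((christoffel G x).hasFDerivAt.comp x h0).clm_apply (hasFDerivAt_const w x))).const_smul
      (1 / 2 : ℝ)).const_sub w
  have h2 : (fun z ↦ fderiv ℝ (normalChange G x) z w) = fun z ↦
      w - (1 / 2 : ℝ) • (christoffel G x w (z - x) + christoffel G x (z - x) w) := by
    ext z
    exact fderiv_normalChange_apply G x z w
  rw [h2] at h
  have := congrArg (fun A : E →L[ℝ] E ↦ A v) (h.unique h1)
  simp at this
  rw [this, hG.christoffel_symm w v]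
  module

theorem IsCoordMetric.fderiv_pullbackForm_normalChange (hG : IsCoordMetric G x) :
    fderiv ℝ (pullbackForm (normalChange G x) G) x = 0 := by
  have hφ := isCoordDiffeo_normalChange G x
  have h := isPullbackAt_pullbackForm (normalChange G x) G x
  have hG' : IsCoordMetric G (normalChange G x x) := by simpa using hG
  ext u v w
  rw [h.fderiv_apply hφ hG', hG.fderiv_fderiv_normalChange, hG.fderiv_fderiv_normalChange,
    fderiv_normalChange_self, normalChange_self]
  simp only [ContinuousLinearMap.id_apply, map_neg, _root_.neg_apply, hG.apply_christoffel,
    hG.symm v, koszulForm_apply, hG.fderiv_apply_symm w u v, hG.fderiv_apply_symm u w v,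
    hG.fderiv_apply_symm v u w]
  simp
  ring

end NormalCoordinates

section FrameAlgebra

variable {κ : Type*} [Fintype κ] [DecidableEq κ]

/-- The Christoffel symbols of the first kind, in an orthonormal frame, of a multiconformal metric
with logarithmic factors proportional to `β`, for a function with differential `n`. -/
def frameKoszul (n β : κ → ℝ) (a b c : κ) : ℝ :=
  n a * β b * (if b = c then 1 else 0) + n b * β a * (if a = c then 1 else 0)
    - n c * β a * (if a = b then 1 else 0)

theorem sum_frameKoszul_sq (n β : κ → ℝ) (a b : κ) :
    ∑ c, frameKoszul n β a b c ^ 2 = n a ^ 2 * β b ^ 2 + n b ^ 2 * β a ^ 2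
      + (if a = b then β a ^ 2 * (∑ c, n c ^ 2) - 2 * (n a ^ 2 * β a ^ 2) else 0) := by
  by_cases h : a = b
  · subst h
    have (c : κ) : frameKoszul n β a a c ^ 2 = β a ^ 2 * n c ^ 2 := by
      unfold frameKoszul
      split_ifs with h
      · subst h; ring
      · simp_all
      · ring
      · simp_all
    simp only [this, ← Finset.mul_sum, if_true]
    ring
  · have (c : κ) : frameKoszul n β a b c ^ 2 =
      (if b = c then n a ^ 2 * β b ^ 2 else 0) + (if a = c then n b ^ 2 * β a ^ 2 else 0) := by
      simp only [frameKoszul, h, if_false]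
      split_ifs with h1 h2
      · exact absurd (h2.trans h1.symm) h
      · ring
      · ring
      · ring
    simp only [this, Finset.sum_add_distrib]
    simp [h]

theorem sum_frameKoszul_mul (n β : κ → ℝ) (a b : κ) :
    ∑ c, frameKoszul n β a a c * frameKoszul n β b b c =
    (if a = b then 4 * (n a ^ 2 * β a ^ 2) else 0) - 2 * (n a ^ 2 * β a) * β b
      - 2 * (n b ^ 2 * β b) * β a + β a * β b * ∑ c, n c ^ 2 := by
  have (c : κ) : frameKoszul n β a a c * frameKoszul n β b b c =
      (if a = c then (if a = b then 4 * (n a ^ 2 * β a ^ 2) else 0) - 2 * (n a ^ 2 * β a) * β b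
        else 0) - (if b = c then 2 * (n b ^ 2 * β b) * β a else 0) + β a * β b * n c ^ 2 := by
    unfold frameKoszul
    by_cases h1 : a = c <;> by_cases h2 : b = c
    · subst h1; subst h2; simp; ring
    · have h3 : a ≠ b := by rintro rfl; exact h2 h1
      subst h1; simp [h2, h3]; ring
    · have h3 : a ≠ b := by rintro rfl; exact h1 h2
      subst h2; simp [h1]; ring
    · simp [h1, h2]; ring
  simp only [this, Finset.sum_add_distrib, Finset.sum_sub_distrib, ← Finset.mul_sum]
  simp

/-- The contribution of the logarithmic factors to the scalar curvature of a multiconformal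
metric. -/
theorem sum_frame_curvature (n β : κ → ℝ) (H : κ → κ → ℝ) (β₀ : ℝ) (hn : ∀ a, n a * β a = β₀ * n a)
    (hH : ∀ a, H a a * β a = β₀ * H a a) (hβ : ∑ a, β a = β₀) :
    ∑ a, ∑ b, ((2 * β b * H a b + 4 * β b ^ 2 * (n a * n b)) * (if b = a then 1 else 0)
      - 1 / 2 * (2 * β b * H a a + 4 * β b ^ 2 * (n a * n a))
      - 1 / 2 * (2 * β a * H b b + 4 * β a ^ 2 * (n b * n b))
      + ∑ c, frameKoszul n β a b c ^ 2
      - ∑ c, frameKoszul n β a a c * frameKoszul n β b b c) =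
    - (∑ a, β a ^ 2 - β₀ ^ 2) * ∑ c, n c ^ 2 := by
  set N := ∑ c, n c ^ 2 with hN
  set T := ∑ a, H a a with hT
  have h1 (a) : n a ^ 2 * β a = β₀ * n a ^ 2 := by rw [sq, mul_assoc, hn]; ring
  have h2 (a) : n a ^ 2 * β a ^ 2 = β₀ ^ 2 * n a ^ 2 := by
    rw [sq (β a), ← mul_assoc, h1, mul_assoc, h1]; ring
  have key (a b : κ) : ((2 * β b * H a b + 4 * β b ^ 2 * (n a * n b)) * (if b = a then 1 else 0)
      - 1 / 2 * (2 * β b * H a a + 4 * β b ^ 2 * (n a * n a))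
      - 1 / 2 * (2 * β a * H b b + 4 * β a ^ 2 * (n b * n b))
      + ∑ c, frameKoszul n β a b c ^ 2
      - ∑ c, frameKoszul n β a a c * frameKoszul n β b b c) =
      (if a = b then 2 * β₀ * H a a + β a ^ 2 * N - 2 * β₀ ^ 2 * n a ^ 2 else 0)
      - H a a * β b - β a * H b b
      - n a ^ 2 * β b ^ 2 - β a ^ 2 * n b ^ 2 + 2 * β₀ * (n a ^ 2 * β b) + 2 * β₀ * (β a * n b ^ 2)
      - N * (β a * β b) := by
    rw [sum_frameKoszul_sq, sum_frameKoszul_mul, h1, h1, h2, ← hN]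
    by_cases h : a = b
    · subst h
      simp only [if_true]
      linear_combination 2 * hH a + 4 * h2 a
    · simp only [h, if_false, Ne.symm h]
      ring
  rw [Finset.sum_congr rfl fun a _ ↦ Finset.sum_congr rfl fun b _ ↦ key a b]
  simp only [Finset.sum_add_distrib, Finset.sum_sub_distrib, ← Finset.mul_sum, ← Finset.sum_mul]
  simp only [Finset.sum_ite_eq, Finset.mem_univ, if_true, Finset.sum_add_distrib,
    Finset.sum_sub_distrib, ← Finset.mul_sum, ← Finset.sum_mul, hβ, ← hT, ← hN]
  ring

end FrameAlgebra

section Multiconformal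

set_option maxSynthPendingDepth 4

variable {ι : Type*} [Fintype ι] {E : ι → Type*} [∀ i, NormedAddCommGroup (E i)]
  [∀ i, NormedSpace ℝ (E i)] {G : ∀ i, E i → E i →L[ℝ] E i →L[ℝ] ℝ} {p : ∀ i, E i}
  {o : ι} {u : E o → ℝ} {β : ι → ℝ}

/-- The metric `∑ exp (2 βᵢ u) Gᵢ` on the product of coordinate spaces, where `u` depends on the
factor `o`. -/
def multiForm (G : ∀ i, E i → E i →L[ℝ] E i →L[ℝ] ℝ) (β : ι → ℝ) (o : ι) (u : E o → ℝ)
    (x : ∀ i, E i) : (∀ i, E i) →L[ℝ] (∀ i, E i) →L[ℝ] ℝ :=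
  ∑ i, Real.exp (2 * β i * u (x o)) • ((ContinuousLinearMap.precomp ℝ (.proj i)) ∘L
    (G i (x i)) ∘L (.proj i))

theorem multiForm_apply (x v w : ∀ i, E i) : multiForm G β o u x v w =
    ∑ i, Real.exp (2 * β i * u (x o)) * G i (x i) (v i) (w i) := by
  simp [multiForm]

theorem isCoordMetric_multiForm (hG : ∀ i, IsCoordMetric (G i) (p i))
    (hu : ∀ᶠ y in 𝓝 (p o), ContDiffAt ℝ ∞ u y) : IsCoordMetric (multiForm G β o u) p := by
  have h1 : ∀ᶠ x in 𝓝 p, ∀ i, IsCoordMetric (G i) (x i) :=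
    eventually_all.2 fun i ↦ (continuous_apply i).continuousAt.eventually (hG i).eventually
  have h2 : ∀ᶠ x in 𝓝 p, ContDiffAt ℝ ∞ u (x o) := (continuous_apply o).continuousAt.eventually hu
  filter_upwards [h1, h2] with x hx hux
  refine ⟨?_, fun v w ↦ ?_, fun v hv ↦ ?_⟩
  · refine ContDiffAt.sum fun i _ ↦ ContDiffAt.fun_smul ?_ ?_
    · have : ContDiffAt ℝ ∞ (fun x : ∀ i, E i ↦ u (x o)) x :=
        ContDiffAt.comp x hux (ContinuousLinearMap.proj (R := ℝ) (φ := E) o).contDiff.contDiffAt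
      exact (contDiffAt_const.mul this).exp
    · have : ContDiffAt ℝ ∞ (fun x : ∀ i, E i ↦ G i (x i)) x :=
        ContDiffAt.comp x (hx i).smooth (ContinuousLinearMap.proj (R := ℝ) (φ := E) i).contDiff.contDiffAt
      exact contDiffAt_const.clm_comp (this.clm_comp contDiffAt_const)
  · simp only [multiForm_apply, fun i ↦ (hx i).symm (v i) (w i)]
  · rw [multiForm_apply]
    obtain ⟨i, hi⟩ := Function.ne_iff.1 hv
    refine Finset.sum_pos' (fun j _ ↦ ?_) ⟨i, Finset.mem_univ i, ?_⟩
    · by_cases hj : v j = 0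
      · simp [hj]
      · exact (mul_pos (Real.exp_pos _) ((hx j).pos hj)).le
    · exact mul_pos (Real.exp_pos _) ((hx i).pos hi)

theorem fderiv_multiForm_apply (hG : ∀ i, IsCoordMetric (G i) (p i))
    (hu : ∀ᶠ y in 𝓝 (p o), ContDiffAt ℝ ∞ u y) (X v w : ∀ i, E i) :
    fderiv ℝ (multiForm G β o u) p X v w = ∑ i, Real.exp (2 * β i * u (p o)) *
      (2 * β i * fderiv ℝ u (p o) (X o) * G i (p i) (v i) (w i) +
        fderiv ℝ (G i) (p i) (X i) (v i) (w i)) := by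
  rw [← fderiv_clm_apply_const₂ (isCoordMetric_multiForm hG hu).differentiableAt]
  simp only [multiForm_apply]
  have h1 : HasFDerivAt (fun x : ∀ i, E i ↦ u (x o)) _ p :=
    (hu.self_of_nhds.differentiableAt (by simp)).hasFDerivAt.comp p (hasFDerivAt_apply o p)
  have h2 (i) : HasFDerivAt (fun x : ∀ i, E i ↦ G i (x i) (v i) (w i)) _ p :=
    HasFDerivAt.comp (g := fun y ↦ G i y (v i) (w i)) p
      ((hG i).differentiableAt.hasFDerivAt.clm_apply_const₂ (v i) (w i)) (hasFDerivAt_apply i p)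
  have h3 := HasFDerivAt.fun_sum (u := Finset.univ) fun i (_ : i ∈ Finset.univ) ↦
    ((h1.const_mul (2 * β i)).exp).fun_mul (h2 i)
  rw [h3.fderiv]
  simp only [_root_.sum_apply]
  refine Finset.sum_congr rfl fun i _ ↦ ?_
  simp
  ring

theorem fderiv_fderiv_multiForm_apply (hG : ∀ i, IsCoordMetric (G i) (p i))
    (hu : ∀ᶠ y in 𝓝 (p o), ContDiffAt ℝ ∞ u y) (h0 : ∀ i, fderiv ℝ (G i) (p i) = 0)
    (X Y v w : ∀ i, E i) :
    fderiv ℝ (fderiv ℝ (multiForm G β o u)) p X Y v w = ∑ i, Real.exp (2 * β i * u (p o)) *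
      ((2 * β i * fderiv ℝ (fderiv ℝ u) (p o) (X o) (Y o)
        + 4 * β i ^ 2 * (fderiv ℝ u (p o) (X o) * fderiv ℝ u (p o) (Y o))) *
          G i (p i) (v i) (w i) +
        fderiv ℝ (fderiv ℝ (G i)) (p i) (X i) (Y i) (v i) (w i)) := by
  have e : (fun x ↦ fderiv ℝ (multiForm G β o u) x Y v w) =ᶠ[𝓝 p]
      fun x ↦ ∑ i, Real.exp (2 * β i * u (x o)) *
      (2 * β i * fderiv ℝ u (x o) (Y o) * G i (x i) (v i) (w i) +
        fderiv ℝ (G i) (x i) (Y i) (v i) (w i)) := by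
    have h1 : ∀ᶠ x in 𝓝 p, ∀ i, IsCoordMetric (G i) (x i) :=
      eventually_all.2 fun i ↦ (continuous_apply i).continuousAt.eventually (hG i).eventually
    have h2 : ∀ᶠ x in 𝓝 p, ∀ᶠ y in 𝓝 (x o), ContDiffAt ℝ ∞ u y :=
      (continuous_apply o).continuousAt.eventually (eventually_eventually_nhds.2 hu)
    filter_upwards [h1, h2] with x hx hux using fderiv_multiForm_apply hx hux Y v w
  have l := (isCoordMetric_multiForm (β := β) hG hu).hasFDerivAt_fderiv_apply Y v w
  have h1 : HasFDerivAt (fun x : ∀ i, E i ↦ u (x o)) _ p :=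
    (hu.self_of_nhds.differentiableAt (by simp)).hasFDerivAt.comp p (hasFDerivAt_apply o p)
  have h1' : HasFDerivAt (fun x : ∀ i, E i ↦ fderiv ℝ u (x o)) _ p :=
    ((hu.self_of_nhds.fderiv_right (m := ∞) (by simp)).differentiableAt
      (by simp)).hasFDerivAt.comp p (hasFDerivAt_apply o p)
  have h2 (i) : HasFDerivAt (fun x : ∀ i, E i ↦ G i (x i) (v i) (w i)) _ p :=
    HasFDerivAt.comp (g := fun y ↦ G i y (v i) (w i)) p
      ((hG i).differentiableAt.hasFDerivAt.clm_apply_const₂ (v i) (w i)) (hasFDerivAt_apply i p)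
  have h4 (i) : HasFDerivAt (fun x : ∀ i, E i ↦ fderiv ℝ (G i) (x i) (Y i) (v i) (w i)) _ p :=
    HasFDerivAt.comp (g := fun y ↦ fderiv ℝ (G i) y (Y i) (v i) (w i)) p
      ((hG i).hasFDerivAt_fderiv_apply (Y i) (v i) (w i)) (hasFDerivAt_apply i p)
  have h3 := HasFDerivAt.fun_sum (u := Finset.univ) fun i (_ : i ∈ Finset.univ) ↦
    ((h1.const_mul (2 * β i)).exp).fun_mul
      (((((h1'.clm_apply (hasFDerivAt_const (Y o) p)).const_mul (2 * β i)).mul (h2 i))).add (h4 i))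
  have := congrArg (fun A : (∀ i, E i) →L[ℝ] ℝ ↦ A X) (l.unique (h3.congr_of_eventuallyEq e))
  simp only [ContinuousLinearMap.flip_apply] at this
  rw [this]
  simp only [_root_.sum_apply]
  refine Finset.sum_congr rfl fun i _ ↦ ?_
  simp [h0]
  ring

/-- The scalar curvature of a multiconformal metric for which the second derivatives of the
logarithmic factors cancel, at a point where the factors have vanishing first derivatives. -/
theorem coordScalarCurvature_multiForm_of_fderiv_eq_zero [∀ i, FiniteDimensional ℝ (E i)]
    (hG : ∀ i, IsCoordMetric (G i) (p i))
    (hu : ∀ᶠ y in 𝓝 (p o), ContDiffAt ℝ ∞ u y) (h0 : ∀ i, fderiv ℝ (G i) (p i) = 0)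
    (hβ : ∑ i, Module.finrank ℝ (E i) * β i = β o) :
    coordScalarCurvature (multiForm G β o u) p =
      ∑ i, Real.exp (-2 * β i * u (p o)) * coordScalarCurvature (G i) (p i)
      - (∑ i, Module.finrank ℝ (E i) * β i ^ 2 - β o ^ 2) * (Real.exp (-2 * β o * u (p o)) *
        fderiv ℝ u (p o) ((G o (p o)).inverse (fderiv ℝ u (p o)))) := by
  classical
  have hex (i) := exists_orthonormal_basis (hG i).symm fun v hv ↦ (hG i).pos hv
  choose b hb using hex
  set t := u (p o) with ht
  have hunit (a : Σ i, Fin (Module.finrank ℝ (E i))) : IsUnit (Real.exp (-β a.1 * t)) :=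
    isUnit_iff_ne_zero.2 (Real.exp_pos _).ne'
  let e := (Pi.basis b).isUnitSMul hunit
  have he (a) : e a = Real.exp (-β a.1 * t) • Pi.single a.1 (b a.1 a.2) := by
    simp [e, Module.Basis.isUnitSMul_apply, Pi.basis_apply]
  have he_same (i k) : e ⟨i, k⟩ i = Real.exp (-β i * t) • b i k := by simp [he]
  have he_ne (a i) (h : i ≠ a.1) : e a i = 0 := by simp [he, h]
  have hS (s : ι) (f : E s → ℝ) (hf : f 0 = 0) :
      ∑ a, f (e a s) = ∑ k, f (Real.exp (-β s * t) • b s k) := by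
    rw [Fintype.sum_sigma, Finset.sum_eq_single s]
    · simp only [he_same]
    · exact fun i _ hi ↦ Finset.sum_eq_zero fun k _ ↦ by rw [he_ne _ _ hi.symm, hf]
    · simp
  have hexp (i) : Real.exp (-β i * t) ^ 2 * Real.exp (2 * β i * t) = 1 := by
    rw [← Real.exp_nat_mul, ← Real.exp_add]
    simp
    ring
  have horth (f : ι → ℝ) (a c) : ∑ i, Real.exp (2 * β i * t) * (f i * G i (p i) (e a i) (e c i)) =
      f c.1 * if a = c then 1 else 0 := by
    obtain ⟨i, k⟩ := a
    obtain ⟨j, l⟩ := c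
    rw [Finset.sum_eq_single j (fun s _ hs ↦ by rw [he_ne ⟨j, l⟩ s hs]; simp) (by simp)]
    by_cases h : i = j
    · subst h
      simp only [he_same, map_smul, _root_.smul_apply, smul_eq_mul, hb, Sigma.mk.injEq,
        heq_eq_eq, true_and]
      linear_combination (f i * if k = l then 1 else 0) * hexp i
    · rw [he_ne ⟨i, k⟩ j (Ne.symm h)]
      simp [h]
  have hH := isCoordMetric_multiForm (β := β) hG hu
  have he_orth (a c) : multiForm G β o u p (e a) (e c) = if a = c then 1 else 0 := by
    simpa [multiForm_apply] using horth (fun _ ↦ 1) a c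
  let n : (Σ i, Fin (Module.finrank ℝ (E i))) → ℝ := fun a ↦ fderiv ℝ u (p o) (e a o)
  let B : (Σ i, Fin (Module.finrank ℝ (E i))) → ℝ := fun a ↦ β a.1
  let Hs := fun a c ↦ fderiv ℝ (fderiv ℝ u) (p o) (e a o) (e c o)
  have hD1 (a c d) : fderiv ℝ (multiForm G β o u) p (e a) (e c) (e d) =
      2 * B c * n a * if c = d then 1 else 0 := by
    rw [fderiv_multiForm_apply hG hu]
    simp only [h0, _root_.zero_apply, add_zero]
    rw [horth (fun i ↦ 2 * β i * fderiv ℝ u (p o) (e a o))]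
    by_cases h : c = d
    · subst h; rfl
    · simp [h]
  have hK (a c d) : koszulForm (multiForm G β o u) p (e a) (e c) (e d) = frameKoszul n B a c d := by
    rw [koszulForm_apply, hD1, hD1, hD1]
    unfold frameKoszul
    by_cases h1 : a = c
    · subst h1; split_ifs <;> ring
    · split_ifs <;> ring
  let q (s : ι) (X Y : E s) : ℝ := fderiv ℝ (fderiv ℝ (G s)) (p s) X Y Y X
    - 1 / 2 * fderiv ℝ (fderiv ℝ (G s)) (p s) X X Y Y
    - 1 / 2 * fderiv ℝ (fderiv ℝ (G s)) (p s) Y Y X X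
  have hq (s) (c : ℝ) (X Y) : q s (c • X) (c • Y) = c ^ 2 * c ^ 2 * q s X Y := by
    simp [q]
    ring
  have hD2 (a c d f) : fderiv ℝ (fderiv ℝ (multiForm G β o u)) p (e a) (e c) (e d) (e f) =
      (2 * B d * Hs a c + 4 * B d ^ 2 * (n a * n c)) * (if d = f then 1 else 0)
      + ∑ i, Real.exp (2 * β i * t) *
        fderiv ℝ (fderiv ℝ (G i)) (p i) (e a i) (e c i) (e d i) (e f i) := by
    rw [fderiv_fderiv_multiForm_apply hG hu h0]
    rw [Finset.sum_congr rfl fun i _ ↦ mul_add _ _ _, Finset.sum_add_distrib]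
    rw [horth (fun i ↦ 2 * β i * fderiv ℝ (fderiv ℝ u) (p o) (e a o) (e c o)
        + 4 * β i ^ 2 * (fderiv ℝ u (p o) (e a o) * fderiv ℝ u (p o) (e c o)))]
    by_cases h : d = f
    · subst h; rfl
    · simp [h, ht]
  have hscal (i) : coordScalarCurvature (G i) (p i) = ∑ k, ∑ l, q i (b i k) (b i l) := by
    rw [(hG i).coordScalarCurvature_eq_sum (b i) (hb i)]
    simp [koszulForm_apply, h0, q]
  have hN : ∑ a, n a ^ 2 = Real.exp (-2 * β o * t) *
      fderiv ℝ u (p o) ((G o (p o)).inverse (fderiv ℝ u (p o))) := by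
    rw [hS o (fun X ↦ fderiv ℝ u (p o) X ^ 2) (by simp)]
    have h1 : fderiv ℝ u (p o) ((G o (p o)).inverse (fderiv ℝ u (p o))) =
        ∑ k, fderiv ℝ u (p o) (b o k) ^ 2 := by
      set g := (G o (p o)).inverse (fderiv ℝ u (p o)) with hg
      have hg' (v) : fderiv ℝ u (p o) v = G o (p o) g v := by
        rw [hg, (hG o).isInvertible.self_apply_inverse]
      have hr (k) : (b o).repr g k = G o (p o) g (b o k) := by
        conv_rhs => rw [← (b o).sum_repr g]
        simp only [map_sum, _root_.sum_apply, map_smul, _root_.smul_apply, hb]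
        simp
      conv_lhs => rw [← (b o).sum_repr g]
      simp only [map_sum, map_smul, smul_eq_mul, hr, ← hg', sq]
    rw [h1, Finset.mul_sum]
    refine Finset.sum_congr rfl fun k _ ↦ ?_
    rw [map_smul, smul_eq_mul, mul_pow, ← Real.exp_nat_mul]
    congr 2
    simp
    ring
  have hkey := sum_frame_curvature n B Hs (β o)
    (fun a ↦ by
      by_cases h : o = a.1
      · simp [B, h, mul_comm]
      · simp [n, he_ne a o h])
    (fun a ↦ by
      by_cases h : o = a.1
      · simp [B, h, mul_comm]
      · simp [Hs, he_ne a o h])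
    (by rw [← hβ, Fintype.sum_sigma]; simp [B])
  have hQ : ∑ a, B a ^ 2 = ∑ i, Module.finrank ℝ (E i) * β i ^ 2 := by
    rw [Fintype.sum_sigma]; simp [B]
  rw [hQ, hN] at hkey
  rw [hH.coordScalarCurvature_eq_sum e he_orth]
  simp only [hK, hD2, if_true]
  have hW : ∑ a, ∑ c, ∑ i, Real.exp (2 * β i * t) * q i (e a i) (e c i) =
      ∑ i, Real.exp (-2 * β i * t) * coordScalarCurvature (G i) (p i) := by
    rw [Finset.sum_congr rfl fun a _ ↦ Finset.sum_comm, Finset.sum_comm]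
    refine Finset.sum_congr rfl fun i _ ↦ ?_
    have h1 (X : E i) : ∑ c, q i X (e c i) = ∑ l, q i X (Real.exp (-β i * t) • b i l) :=
      hS i (fun Y ↦ q i X Y) (by simp [q])
    simp only [← Finset.mul_sum, h1]
    rw [hS i (fun X ↦ ∑ l, q i X (Real.exp (-β i * t) • b i l)) (by simp [q])]
    simp only [hq, ← Finset.mul_sum, ← hscal]
    have h2 : Real.exp (-2 * β i * t) = Real.exp (-β i * t) ^ 2 := by
      rw [← Real.exp_nat_mul]
      congr 1
      simp
      ring
    rw [h2]
    linear_combination (Real.exp (-β i * t) ^ 2 * coordScalarCurvature (G i) (p i)) * hexp i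
  rw [← hW, sub_eq_add_neg, ← neg_mul, ← hkey, ← Finset.sum_add_distrib]
  refine Finset.sum_congr rfl fun a _ ↦ ?_
  rw [← Finset.sum_add_distrib]
  refine Finset.sum_congr rfl fun c _ ↦ ?_
  simp only [q, mul_sub, Finset.sum_sub_distrib, mul_left_comm _ (1 / 2 : ℝ), ← Finset.mul_sum]
  ring

/-- The scalar curvature of a multiconformal metric for which the second derivatives of the
logarithmic factors cancel. -/
theorem coordScalarCurvature_multiForm [∀ i, FiniteDimensional ℝ (E i)]
    (hG : ∀ i, IsCoordMetric (G i) (p i))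
    (hu : ∀ᶠ y in 𝓝 (p o), ContDiffAt ℝ ∞ u y)
    (hβ : ∑ i, Module.finrank ℝ (E i) * β i = β o) :
    coordScalarCurvature (multiForm G β o u) p =
      ∑ i, Real.exp (-2 * β i * u (p o)) * coordScalarCurvature (G i) (p i)
      - (∑ i, Module.finrank ℝ (E i) * β i ^ 2 - β o ^ 2) * (Real.exp (-2 * β o * u (p o)) *
        fderiv ℝ u (p o) ((G o (p o)).inverse (fderiv ℝ u (p o)))) := by
  let φ (i) := normalChange (G i) (p i)
  let G' (i) := pullbackForm (φ i) (G i)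
  let Φ : (∀ i, E i) → ∀ i, E i := fun x i ↦ φ i (x i)
  have hφ (i) : IsCoordDiffeo (φ i) (p i) := isCoordDiffeo_normalChange _ _
  have hφp (i) : φ i (p i) = p i := normalChange_self _ _
  have hφd (i) : fderiv ℝ (φ i) (p i) = .id ℝ (E i) := fderiv_normalChange_self _ _
  have hGφ (i) : IsCoordMetric (G i) (φ i (p i)) := by rw [hφp]; exact hG i
  have hpb (i) : IsPullbackAt (φ i) (G i) (G' i) (p i) := isPullbackAt_pullbackForm _ _ _
  have hG' (i) : IsCoordMetric (G' i) (p i) := (hpb i).isCoordMetric (hφ i) (hGφ i)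
  have hΦp : Φ p = p := funext hφp
  have hΦc : ContDiff ℝ ∞ Φ := contDiff_pi.2 fun i ↦
    (contDiff_normalChange (G i) (p i)).comp (ContinuousLinearMap.proj (R := ℝ) (φ := E) i).contDiff
  have hΦd (x v i) : fderiv ℝ Φ x v i = fderiv ℝ (φ i) (x i) (v i) := by
    have h : HasFDerivAt Φ (ContinuousLinearMap.pi fun i ↦
        (fderiv ℝ (φ i) (x i)) ∘L (ContinuousLinearMap.proj i)) x := by
      refine hasFDerivAt_pi.2 fun i ↦ ?_
      exact HasFDerivAt.comp x (((contDiff_normalChange (G i) (p i)).differentiable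
        (by simp)).differentiableAt.hasFDerivAt) (hasFDerivAt_apply i x)
    rw [h.fderiv]
    rfl
  have hΦ : IsCoordDiffeo Φ p := by
    have (i : ι) := FiniteDimensional.complete ℝ (E i)
    refine isCoordDiffeo_of_contDiff hΦc ⟨ContinuousLinearEquiv.refl ℝ _, ?_⟩
    ext v i
    simp [hΦd, hφd]
  have hu' : ∀ᶠ y in 𝓝 (p o), ContDiffAt ℝ ∞ (u ∘ φ o) y := by
    have h1 : ∀ᶠ y in 𝓝 (p o), ContDiffAt ℝ ∞ u (φ o y) := by
      refine (hφ o).differentiableAt.continuousAt.eventually ?_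
      rw [hφp]
      exact hu
    filter_upwards [h1, hφ o] with y hy hy' using hy.comp y hy'.1
  have hpbΦ : IsPullbackAt Φ (multiForm G β o u) (multiForm G' β o (u ∘ φ o)) p :=
    Eventually.of_forall fun z v w ↦ by
      simp only [multiForm_apply, hΦd]
      rfl
  have hm : IsCoordMetric (multiForm G β o u) (Φ p) := by
    rw [hΦp]
    exact isCoordMetric_multiForm hG hu
  have h := hpbΦ.coordScalarCurvature_eq hΦ hm
  have hi (i) : coordScalarCurvature (G' i) (p i) = coordScalarCurvature (G i) (p i) := by
    rw [(hpb i).coordScalarCurvature_eq (hφ i) (hGφ i), hφp]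
  have hGp : G' o (p o) = G o (p o) := by
    ext v w
    rw [pullbackForm_apply, hφp, hφd]
    rfl
  have hud : fderiv ℝ (u ∘ φ o) (p o) = fderiv ℝ u (p o) := by
    rw [fderiv_comp, hφd, hφp]
    · rfl
    · rw [hφp]
      exact hu.self_of_nhds.differentiableAt (by simp)
    · exact (hφ o).differentiableAt
  rw [hΦp] at h
  rw [← h, coordScalarCurvature_multiForm_of_fderiv_eq_zero hG' hu'
    (fun i ↦ (hG i).fderiv_pullbackForm_normalChange) hβ]
  simp only [hi, hGp, hud, Function.comp_apply, hφp]

end Multiconformal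

section MetricInChart

variable {E : Type*} [NormedAddCommGroup E] [NormedSpace ℝ E]
  {H : Type*} [TopologicalSpace H] {I : ModelWithCorners ℝ E H}
  {M : Type*} [TopologicalSpace M] [ChartedSpace H M]

theorem contMDiffAt_clm_of_apply {F F' : Type*} [NormedAddCommGroup F] [NormedSpace ℝ F]
    [NormedAddCommGroup F'] [NormedSpace ℝ F'] [FiniteDimensional ℝ F] {f : M → F →L[ℝ] F'} {x : M}
    (h : ∀ v, ContMDiffAt I 𝓘(ℝ, F') ∞ (fun z ↦ f z v) x) :
    ContMDiffAt I 𝓘(ℝ, F →L[ℝ] F') ∞ f x := by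
  let d := Module.finrank ℝ F
  have hd : d = Module.finrank ℝ (Fin d → ℝ) := (Module.finrank_fin_fun ℝ).symm
  let e₁ := ContinuousLinearEquiv.ofFinrankEq hd
  let e₂ := (e₁.arrowCongr (1 : F' ≃L[ℝ] F')).trans (ContinuousLinearEquiv.piRing (Fin d))
  rw [← Function.id_comp f, ← e₂.symm_comp_self]
  have h1 : ContMDiffAt I 𝓘(ℝ, Fin d → F') ∞ (e₂ ∘ f) x := contMDiffAt_pi_space.2 fun i ↦ h _
  exact e₂.symm.contDiff.contMDiff.contMDiffAt.comp x h1

theorem mfderiv_extChartAt_symm_eq [I.Boundaryless] (q : M) (y : E) :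
    mfderiv 𝓘(ℝ, E) I (extChartAt I q).symm y =
      mfderivWithin 𝓘(ℝ, E) I (extChartAt I q).symm (Set.range I) y := by
  rw [I.range_eq_univ, mfderivWithin_univ]

variable [IsManifold I ∞ M]

theorem isManifold_one : IsManifold I 1 M := IsManifold.of_le (n := ∞) (by simp)

theorem metricInChart_apply (h : SmoothMetric I M) (q : M) (y v w : E) :
    metricInChart h q y v w = h.inner ((extChartAt I q).symm y)
      (mfderiv 𝓘(ℝ, E) I (extChartAt I q).symm y v)
      (mfderiv 𝓘(ℝ, E) I (extChartAt I q).symm y w) := rfl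

/-- The vector field on a chart domain with constant coordinates. -/
theorem contMDiffAt_symmL_trivializationAt {q x : M} (hx : x ∈ (chartAt H q).source) (v : E) :
    ContMDiffAt I (I.prod 𝓘(ℝ, E)) ∞ (fun x ↦ Bundle.TotalSpace.mk' E (E := TangentSpace I) x
      ((trivializationAt E (TangentSpace I) q).symmL ℝ x v)) x := by
  have h1 := (trivializationAt E (TangentSpace I : M → Type _) q).contMDiffAt_symmL (IB := I) (n := ∞)
    (x := x) (by simpa using hx)
  have h2 : ContMDiffAt I (I.prod 𝓘(ℝ, E)) ∞
    (fun x ↦ Bundle.TotalSpace.mk' E (E := Bundle.Trivial M E) x v) x :=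
    (Bundle.contMDiffAt_section x).2 (by simpa using contMDiffAt_const)
  exact ContMDiffAt.clm_bundle_apply (F₁ := E) (F₂ := E) (E₁ := Bundle.Trivial M E) h1 h2

/-- A family of bilinear forms on the tangent spaces is smooth if it is smooth when applied to
vector fields with constant coordinates. -/
theorem contMDiff_bilinear_section [FiniteDimensional ℝ E]
    {s : ∀ x : M, TangentSpace I x →L[ℝ] TangentSpace I x →L[ℝ] ℝ}
    (hs : ∀ (q : M) (v w : E), ContMDiffAt I 𝓘(ℝ, ℝ) ∞
      (fun x ↦ s x ((trivializationAt E (TangentSpace I) q).symmL ℝ x v)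
        ((trivializationAt E (TangentSpace I) q).symmL ℝ x w)) q) :
    ContMDiff I (I.prod 𝓘(ℝ, E →L[ℝ] E →L[ℝ] ℝ)) ∞
      (fun x ↦ Bundle.TotalSpace.mk' (E →L[ℝ] E →L[ℝ] ℝ) x (s x)) := by
  intro q
  rw [Bundle.contMDiffAt_section]
  refine contMDiffAt_clm_of_apply fun v ↦ contMDiffAt_clm_of_apply fun w ↦
    (hs q v w).congr_of_eventuallyEq ?_
  filter_upwards [(chartAt H q).open_source.mem_nhds (mem_chart_source H q)] with x hx
  rw [hom_trivializationAt_apply]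
  have hx' : x ∈ (trivializationAt E (TangentSpace I) q).baseSet := by simpa using hx
  simp only [ContinuousLinearMap.inCoordinates, ContinuousLinearMap.comp_apply]
  rw [Bundle.Trivialization.continuousLinearMapAt_apply, Bundle.Trivialization.linearMapAt_apply]
  have hx'' : x ∈ (trivializationAt (E →L[ℝ] ℝ) (fun x : M ↦ TangentSpace I x →L[ℝ] ℝ) q).baseSet :=
    ⟨hx', Set.mem_univ _⟩
  rw [if_pos hx'', hom_trivializationAt_apply]
  simp [ContinuousLinearMap.inCoordinates]

variable [I.Boundaryless]

theorem symmL_trivializationAt_extChartAt_symm {q : M} {z : E} (hz : z ∈ (extChartAt I q).target)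
    (v : E) : (trivializationAt E (TangentSpace I : M → Type _) q).symmL ℝ ((extChartAt I q).symm z)
      v = mfderiv 𝓘(ℝ, E) I (extChartAt I q).symm z v := by
  have : IsManifold I 1 M := isManifold_one
  have hz' : (extChartAt I q).symm z ∈ (chartAt H q).source := by
    simpa using (extChartAt I q).map_target hz
  rw [TangentBundle.symmL_trivializationAt hz', mfderiv_extChartAt_symm_eq]
  exact congrArg (fun t ↦ (mfderivWithin 𝓘(ℝ, E) I (extChartAt I q).symm (Set.range I) t :
    E →L[ℝ] E) v) ((extChartAt I q).right_inv hz)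

theorem isInvertible_mfderiv_extChartAt_symm {q : M} {y : E} (hy : y ∈ (extChartAt I q).target) :
    (mfderiv 𝓘(ℝ, E) I (extChartAt I q).symm y).IsInvertible := by
  have : IsManifold I 1 M := isManifold_one
  rw [mfderiv_extChartAt_symm_eq]
  exact isInvertible_mfderivWithin_extChartAt_symm hy

theorem contMDiffAt_extChartAt_symm {q : M} {y : E} (hy : y ∈ (extChartAt I q).target) :
    ContMDiffAt 𝓘(ℝ, E) I ∞ (extChartAt I q).symm y :=
  (contMDiffOn_extChartAt_symm q).contMDiffAt ((isOpen_extChartAt_target q).mem_nhds hy)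

theorem mdifferentiableAt_extChartAt_symm {q : M} {y : E} (hy : y ∈ (extChartAt I q).target) :
    MDifferentiableAt 𝓘(ℝ, E) I (extChartAt I q).symm y :=
  (contMDiffAt_extChartAt_symm hy).mdifferentiableAt (by simp)

theorem contDiffAt_metricInChart [FiniteDimensional ℝ E] (h : SmoothMetric I M) (q : M) {y : E}
    (hy : y ∈ (extChartAt I q).target) : ContDiffAt ℝ ∞ (metricInChart h q) y := by
  have : IsManifold I 1 M := isManifold_one
  have hx : (extChartAt I q).symm y ∈ (chartAt H q).source := by
    simpa using (extChartAt I q).map_target hy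
  have key (v w : E) : ContDiffAt ℝ ∞ (fun y ↦ metricInChart h q y v w) y := by
    have h1 : ContMDiffAt I (I.prod 𝓘(ℝ)) ∞ (fun x ↦ Bundle.TotalSpace.mk' ℝ
        (E := Bundle.Trivial M ℝ) x (h.inner x
          ((trivializationAt E (TangentSpace I) q).symmL ℝ x v)
          ((trivializationAt E (TangentSpace I) q).symmL ℝ x w))) ((extChartAt I q).symm y) := by
      apply ContMDiffAt.clm_bundle_apply₂ (F₁ := E) (F₂ := E)
      · exact h.contMDiff.contMDiffAt
      · exact contMDiffAt_symmL_trivializationAt hx v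
      · exact contMDiffAt_symmL_trivializationAt hx w
    rw [Bundle.contMDiffAt_section] at h1
    have h2 := (ContMDiffAt.comp y h1 (contMDiffAt_extChartAt_symm hy)).contDiffAt
    refine h2.congr_of_eventuallyEq ?_
    filter_upwards [(isOpen_extChartAt_target q).mem_nhds hy] with z hz
    simp only [Function.comp_apply, symmL_trivializationAt_extChartAt_symm hz]
    rfl
  rw [← contMDiffAt_iff_contDiffAt]
  exact contMDiffAt_clm_of_apply fun v ↦ contMDiffAt_clm_of_apply fun w ↦ (key v w).contMDiffAt

theorem isCoordMetric_metricInChart [FiniteDimensional ℝ E] (h : SmoothMetric I M) (q : M) {y : E}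
    (hy : y ∈ (extChartAt I q).target) : IsCoordMetric (metricInChart h q) y := by
  filter_upwards [(isOpen_extChartAt_target q).mem_nhds hy] with z hz
  refine ⟨contDiffAt_metricInChart h q hz, fun v w ↦ h.symm _ _ _, fun v hv ↦ h.pos _ _ fun h0 ↦ hv ?_⟩
  exact (isInvertible_mfderiv_extChartAt_symm hz).injective (h0.trans (map_zero _).symm)

/-- Transition maps of charts are local diffeomorphisms. -/
theorem isCoordDiffeo_extChartAt [CompleteSpace E] {p q : M} {y : E}
    (hy : y ∈ (extChartAt I p).target)
    (hq : (extChartAt I p).symm y ∈ (extChartAt I q).source) :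
    IsCoordDiffeo (extChartAt I q ∘ (extChartAt I p).symm) y := by
  have : IsManifold I 1 M := isManifold_one
  have hc := (contMDiffAt_extChartAt_symm hy).continuousAt
  filter_upwards [(isOpen_extChartAt_target p).mem_nhds hy,
    hc.eventually ((isOpen_extChartAt_source q).mem_nhds hq)] with z hz
      (hzq : (extChartAt I p).symm z ∈ (extChartAt I q).source)
  have h1 : ContMDiffAt I 𝓘(ℝ, E) ∞ (extChartAt I q) ((extChartAt I p).symm z) :=
    contMDiffAt_extChartAt' (by rwa [extChartAt_source] at hzq)
  refine ⟨(h1.comp z (contMDiffAt_extChartAt_symm hz)).contDiffAt, ?_⟩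
  rw [← mfderiv_eq_fderiv, mfderiv_comp z (h1.mdifferentiableAt (by simp))
    (mdifferentiableAt_extChartAt_symm hz)]
  exact (isInvertible_mfderiv_extChartAt hzq).comp (isInvertible_mfderiv_extChartAt_symm hz)

theorem isPullbackAt_extChartAt {p q : M} (h : SmoothMetric I M) {y : E}
    (hy : y ∈ (extChartAt I p).target)
    (hq : (extChartAt I p).symm y ∈ (extChartAt I q).source) :
    IsPullbackAt (extChartAt I q ∘ (extChartAt I p).symm) (metricInChart h q)
      (metricInChart h p) y := by
  have hc := (contMDiffAt_extChartAt_symm hy).continuousAt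
  have hev := ((isOpen_extChartAt_target p).mem_nhds hy)
  have hev' := hc.eventually ((isOpen_extChartAt_source q).mem_nhds hq)
  filter_upwards [eventually_eventually_nhds.2 hev, eventually_eventually_nhds.2 hev'] with z hzz hzzq
  have hz := hzz.self_of_nhds
  have hzq : (extChartAt I p).symm z ∈ (extChartAt I q).source := hzzq.self_of_nhds
  intro v w
  have e : (extChartAt I p).symm =ᶠ[𝓝 z]
      (extChartAt I q).symm ∘ (extChartAt I q ∘ (extChartAt I p).symm) := by
    filter_upwards [hzzq] with t ht
    exact ((extChartAt I q).left_inv ht).symm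
  have h1 : ContMDiffAt I 𝓘(ℝ, E) ∞ (extChartAt I q) ((extChartAt I p).symm z) :=
    contMDiffAt_extChartAt' (by rwa [extChartAt_source] at hzq)
  have h2 : ContMDiffAt 𝓘(ℝ, E) 𝓘(ℝ, E) ∞ (extChartAt I q ∘ (extChartAt I p).symm) z :=
    h1.comp z (contMDiffAt_extChartAt_symm hz)
  have h3 : mfderiv 𝓘(ℝ, E) I (extChartAt I p).symm z =
      (mfderiv 𝓘(ℝ, E) I (extChartAt I q).symm (extChartAt I q ((extChartAt I p).symm z))).comp
        (fderiv ℝ (extChartAt I q ∘ (extChartAt I p).symm) z) := by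
    rw [e.mfderiv_eq, mfderiv_comp z (mdifferentiableAt_extChartAt_symm
      ((extChartAt I q).map_source hzq)) (h2.mdifferentiableAt (by simp)), mfderiv_eq_fderiv]
    rfl
  have h4 : (extChartAt I q).symm (extChartAt I q ((extChartAt I p).symm z)) =
    (extChartAt I p).symm z := (extChartAt I q).left_inv hzq
  rw [metricInChart_apply, metricInChart_apply, h3]
  simp only [Function.comp_apply]
  rw [h4]
  rfl

/-- The scalar curvature can be computed in any chart. -/
theorem scalarCurvature_eq_of_mem_source [FiniteDimensional ℝ E] (h : SmoothMetric I M) {q x : M}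
    (hx : x ∈ (extChartAt I q).source) :
    scalarCurvature h x = coordScalarCurvature (metricInChart h q) (extChartAt I q x) := by
  have := FiniteDimensional.complete ℝ E
  have hs : (extChartAt I x).symm (extChartAt I x x) = x := extChartAt_to_inv x
  have hy := mem_extChartAt_target (I := I) x
  have hq : (extChartAt I x).symm (extChartAt I x x) ∈ (extChartAt I q).source := by rwa [hs]
  have h1 := (isPullbackAt_extChartAt h hy hq).coordScalarCurvature_eq
    (isCoordDiffeo_extChartAt hy hq)
    (isCoordMetric_metricInChart h q ((extChartAt I q).map_source hq))
  rw [Function.comp_apply, hs] at h1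
  exact h1

theorem continuous_scalarCurvature [FiniteDimensional ℝ E] (h : SmoothMetric I M) :
    Continuous (scalarCurvature h) := by
  refine continuous_iff_continuousAt.2 fun x ↦ ?_
  have h1 : ContinuousAt (fun z ↦ coordScalarCurvature (metricInChart h x) (extChartAt I x z)) x :=
    ContinuousAt.comp (g := coordScalarCurvature (metricInChart h x)) (isCoordMetric_metricInChart h x
      (mem_extChartAt_target x)).continuousAt_coordScalarCurvature (continuousAt_extChartAt x)
  refine h1.congr ?_
  filter_upwards [extChartAt_source_mem_nhds (I := I) x] with z hz
  exact (scalarCurvature_eq_of_mem_source h hz).symm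

end MetricInChart

section GramDet

variable {E : Type*} [NormedAddCommGroup E] [NormedSpace ℝ E] [FiniteDimensional ℝ E]

/-- The determinant of the Gram matrix of a bilinear form in the basis used to normalize volumes. -/
def gramDet (A : E →L[ℝ] E →L[ℝ] ℝ) : ℝ :=
  Matrix.det (Matrix.of fun i j ↦ A (Module.finBasis ℝ E i) (Module.finBasis ℝ E j))

theorem gramDet_of_comp {A A' : E →L[ℝ] E →L[ℝ] ℝ} (L : E →ₗ[ℝ] E)
    (h : ∀ v w, A' v w = A (L v) (L w)) : gramDet A' = LinearMap.det L ^ 2 * gramDet A := by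
  let b := Module.finBasis ℝ E
  have h1 : (Matrix.of fun i j ↦ A' (b i) (b j)) =
      (LinearMap.toMatrix b b L).transpose * (Matrix.of fun i j ↦ A (b i) (b j)) *
        LinearMap.toMatrix b b L := by
    ext i j
    have hL (i) : L (b i) = ∑ k, LinearMap.toMatrix b b L k i • b k := by
      conv_lhs => rw [← b.sum_repr (L (b i))]
      simp [LinearMap.toMatrix_apply]
    rw [Matrix.of_apply, h, hL i, hL j]
    simp only [map_sum, map_smul, _root_.sum_apply, _root_.smul_apply, smul_eq_mul,
      Matrix.mul_apply, Matrix.transpose_apply, Matrix.of_apply, Finset.sum_mul, Finset.mul_sum]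
    refine Finset.sum_congr rfl fun k _ ↦ Finset.sum_congr rfl fun l _ ↦ ?_
    ring
  unfold gramDet
  change Matrix.det (Matrix.of fun i j ↦ A' (b i) (b j)) = _
  rw [h1, Matrix.det_mul, Matrix.det_mul, Matrix.det_transpose, LinearMap.det_toMatrix]
  change _ * Matrix.det (Matrix.of fun i j ↦ A (b i) (b j)) * _ = _ *
    Matrix.det (Matrix.of fun i j ↦ A (b i) (b j))
  ring

theorem gramDet_pos {A : E →L[ℝ] E →L[ℝ] ℝ} (hs : ∀ v w, A v w = A w v)
    (hp : ∀ v, v ≠ 0 → 0 < A v v) : 0 < gramDet A := by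
  obtain ⟨e, he⟩ := exists_orthonormal_basis hs hp
  let b := Module.finBasis ℝ E
  let L : E →ₗ[ℝ] E := b.constr ℝ e
  let A' : E →L[ℝ] E →L[ℝ] ℝ := (ContinuousLinearMap.precomp ℝ L.toContinuousLinearMap) ∘L A ∘L
    L.toContinuousLinearMap
  have h1 := gramDet_of_comp (A := A) (A' := A') L fun v w ↦ rfl
  have h2 : gramDet A' = 1 := by
    have : (Matrix.of fun i j ↦ A' (b i) (b j)) = 1 := by
      ext i j
      have : A' (b i) (b j) = A (L (b i)) (L (b j)) := rfl
      rw [Matrix.of_apply, this]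
      simp [L, he, Matrix.one_apply]
    unfold gramDet
    rw [this, Matrix.det_one]
  rw [h2] at h1
  by_contra h
  nlinarith [sq_nonneg (LinearMap.det L)]

theorem continuous_gramDet : Continuous (gramDet : (E →L[ℝ] E →L[ℝ] ℝ) → ℝ) := by
  unfold gramDet
  refine Continuous.matrix_det (continuous_matrix fun i j ↦ ?_)
  simp only [Matrix.of_apply]
  fun_prop

end GramDet

section Volume

theorem measurableSet_symm_preimage_inter_target {E : Type*} [NormedAddCommGroup E]
    [NormedSpace ℝ E] [MeasurableSpace E] [BorelSpace E] {H : Type*} [TopologicalSpace H]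
    {I : ModelWithCorners ℝ E H} [I.Boundaryless] {M : Type*} [TopologicalSpace M]
    [ChartedSpace H M] [MeasurableSpace M] [BorelSpace M] (p : M) {A : Set M} (hA : MeasurableSet A) :
    MeasurableSet ((extChartAt I p).symm ⁻¹' A ∩ (extChartAt I p).target) := by
  have h1 : Measurable ((extChartAt I p).target.domRestrict (extChartAt I p).symm) :=
    (continuousOn_iff_continuous_domRestrict.1 (continuousOn_extChartAt_symm p)).measurable
  have h2 := (isOpen_extChartAt_target (I := I) p).measurableSet.subtype_image (h1 hA)
  convert h2 using 1
  ext y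
  constructor
  · exact fun hy ↦ ⟨⟨y, hy.2⟩, hy.1, rfl⟩
  · rintro ⟨z, hz, rfl⟩
    exact ⟨hz, z.2⟩

variable {E : Type*} [NormedAddCommGroup E] [NormedSpace ℝ E] [FiniteDimensional ℝ E]
  {H : Type*} [TopologicalSpace H] {I : ModelWithCorners ℝ E H}
  {M : Type*} [TopologicalSpace M] [ChartedSpace H M] [IsManifold I ∞ M]

/-- The density of the volume in a chart. -/
def chartDensity (h : SmoothMetric I M) (p : M) (y : E) : ENNReal :=
  ENNReal.ofReal (Real.sqrt (gramDet (metricInChart h p y)))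

variable [I.Boundaryless]

theorem continuousOn_gramDet_metricInChart (h : SmoothMetric I M) (p : M) :
    ContinuousOn (fun y ↦ gramDet (metricInChart h p y)) (extChartAt I p).target := fun _ hy ↦
  (continuous_gramDet.continuousAt.comp
    (contDiffAt_metricInChart h p hy).continuousAt).continuousWithinAt

theorem continuousOn_chartDensity (h : SmoothMetric I M) (p : M) :
    ContinuousOn (chartDensity h p) (extChartAt I p).target :=
  ENNReal.continuous_ofReal.comp_continuousOn
    (Real.continuous_sqrt.comp_continuousOn (continuousOn_gramDet_metricInChart h p))

theorem gramDet_metricInChart_pos (h : SmoothMetric I M) {p : M} {y : E}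
    (hy : y ∈ (extChartAt I p).target) : 0 < gramDet (metricInChart h p y) :=
  gramDet_pos (isCoordMetric_metricInChart h p hy).symm
    fun _ hv ↦ (isCoordMetric_metricInChart h p hy).pos hv

theorem chartDensity_pos (h : SmoothMetric I M) {p : M} {y : E}
    (hy : y ∈ (extChartAt I p).target) : 0 < chartDensity h p y :=
  ENNReal.ofReal_pos.2 (Real.sqrt_pos.2 (gramDet_metricInChart_pos h hy))

variable [MeasurableSpace E] [BorelSpace E] [MeasurableSpace M] [BorelSpace M]

theorem chartVolume_apply (h : SmoothMetric I M) (p : M) {A : Set M} (hA : MeasurableSet A) :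
    chartVolume h p A = ∫⁻ y in (extChartAt I p).symm ⁻¹' A ∩ (extChartAt I p).target,
      chartDensity h p y ∂(Module.finBasis ℝ E).addHaar := by
  have ho := (isOpen_extChartAt_target (I := I) p).measurableSet
  have h1 : AEMeasurable (extChartAt I p).symm
      ((Module.finBasis ℝ E).addHaar.restrict (extChartAt I p).target) :=
    (continuousOn_extChartAt_symm p).aemeasurable ho
  unfold chartVolume
  rw [Measure.map_apply_of_aemeasurable (h1.mono_ac (withDensity_absolutelyContinuous _ _)) hA,
    withDensity_apply', Measure.restrict_restrict' ho]
  rfl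

/-- The change of variables formula for the volumes in two charts. -/
theorem chartVolume_eq_of_subset (h : SmoothMetric I M) {p q : M} {A : Set M}
    (hA : MeasurableSet A) (hp : A ⊆ (extChartAt I p).source) (hq : A ⊆ (extChartAt I q).source) :
    chartVolume h p A = chartVolume h q A := by
  have := FiniteDimensional.complete ℝ E
  rw [chartVolume_apply h p hA, chartVolume_apply h q hA]
  set S := (extChartAt I p).symm ⁻¹' A ∩ (extChartAt I p).target with hS
  set φ := extChartAt I q ∘ (extChartAt I p).symm with hφ
  have himage : (extChartAt I q).symm ⁻¹' A ∩ (extChartAt I q).target = φ '' S := by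
    ext z
    constructor
    · rintro ⟨hzA, hz⟩
      refine ⟨extChartAt I p ((extChartAt I q).symm z), ⟨?_, (extChartAt I p).map_source (hp hzA)⟩, ?_⟩
      · rw [Set.mem_preimage, (extChartAt I p).left_inv (hp hzA)]
        exact hzA
      · rw [hφ, Function.comp_apply, (extChartAt I p).left_inv (hp hzA),
          (extChartAt I q).right_inv hz]
    · rintro ⟨y, ⟨hyA, hy⟩, rfl⟩
      refine ⟨?_, (extChartAt I q).map_source (hq hyA)⟩
      rw [Set.mem_preimage, hφ, Function.comp_apply, (extChartAt I q).left_inv (hq hyA)]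
      exact hyA
  have hinj : Set.InjOn φ S := by
    rintro y ⟨hyA, hy⟩ z ⟨hzA, hz⟩ hyz
    have h1 := (extChartAt I q).injOn (hq hyA) (hq hzA) hyz
    exact (extChartAt I p).symm.injOn hy hz h1
  have hd (y) (hy : y ∈ S) : IsCoordDiffeo φ y := isCoordDiffeo_extChartAt hy.2 (hq hy.1)
  rw [himage, lintegral_image_eq_lintegral_abs_det_fderiv_mul _
    (measurableSet_symm_preimage_inter_target p hA)
    (fun y hy ↦ (hd y hy).differentiableAt.hasFDerivAt.hasFDerivWithinAt) hinj]
  refine setLIntegral_congr_fun (measurableSet_symm_preimage_inter_target p hA) fun y hy ↦ ?_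
  have hpb := isPullbackAt_extChartAt h hy.2 (hq hy.1)
  have hg := gramDet_of_comp (A := metricInChart h q (φ y)) (A' := metricInChart h p y)
    (fderiv ℝ φ y).toLinearMap hpb.self_of_nhds
  rw [chartDensity, hg, Real.sqrt_mul (sq_nonneg _), Real.sqrt_sq_eq_abs,
    ENNReal.ofReal_mul (abs_nonneg _)]
  rfl

theorem chartVolume_inter_source (h : SmoothMetric I M) (p : M) {A : Set M}
    (hA : MeasurableSet A) :
    chartVolume h p (A ∩ (extChartAt I p).source) = chartVolume h p A := by
  rw [chartVolume_apply h p (hA.inter (isOpen_extChartAt_source p).measurableSet),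
    chartVolume_apply h p hA]
  congr 2
  ext y
  simp only [Set.mem_inter_iff, Set.mem_preimage]
  exact ⟨fun hy ↦ ⟨hy.1.1, hy.2⟩, fun hy ↦ ⟨⟨hy.1, (extChartAt I p).map_target hy.2⟩, hy.2⟩⟩

theorem exists_open_chartVolume_lt_top (h : SmoothMetric I M) (p : M) :
    ∃ U : Set M, IsOpen U ∧ p ∈ U ∧ U ⊆ (extChartAt I p).source ∧ chartVolume h p U < ⊤ := by
  have := FiniteDimensional.proper ℝ E
  obtain ⟨K, hK, hKn, hKt⟩ := exists_compact_subset (isOpen_extChartAt_target (I := I) p)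
    (mem_extChartAt_target p)
  have hU : IsOpen ((extChartAt I p).source ∩ extChartAt I p ⁻¹' interior K) :=
    isOpen_extChartAt_preimage' p isOpen_interior
  refine ⟨_, hU, ⟨mem_extChartAt_source p, hKn⟩, Set.inter_subset_left, ?_⟩
  rw [chartVolume_apply h p hU.measurableSet]
  have hsub : (extChartAt I p).symm ⁻¹' ((extChartAt I p).source ∩ extChartAt I p ⁻¹' interior K) ∩
      (extChartAt I p).target ⊆ K := by
    rintro y ⟨⟨-, hy⟩, hyt⟩
    rw [Set.mem_preimage, (extChartAt I p).right_inv hyt] at hy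
    exact interior_subset hy
  obtain ⟨C, hC⟩ := (hK.image_of_continuousOn
    (Real.continuous_sqrt.comp_continuousOn
      ((continuousOn_gramDet_metricInChart h p).mono hKt))).bddAbove
  calc ∫⁻ y in _, chartDensity h p y ∂(Module.finBasis ℝ E).addHaar
      ≤ ∫⁻ y in K, chartDensity h p y ∂(Module.finBasis ℝ E).addHaar := lintegral_mono_set hsub
    _ ≤ ∫⁻ y in K, ENNReal.ofReal C ∂(Module.finBasis ℝ E).addHaar := by
        refine setLIntegral_mono' hK.measurableSet fun y hy ↦ ?_
        exact ENNReal.ofReal_le_ofReal (hC ⟨y, hy, rfl⟩)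
    _ < ⊤ := by
        rw [setLIntegral_const]
        exact ENNReal.mul_lt_top ENNReal.ofReal_lt_top hK.measure_lt_top

/-- The volume of a compact Riemannian manifold is finite. -/
theorem isFiniteMeasure_riemannianVolume [CompactSpace M] (h : SmoothMetric I M) :
    IsFiniteMeasure (riemannianVolume h) := by
  choose U hUo hUm hUs hUf using exists_open_chartVolume_lt_top h
  obtain ⟨t, ht⟩ := isCompact_univ.elim_finite_subcover U hUo
    fun x _ ↦ Set.mem_iUnion.2 ⟨x, hUm x⟩
  let ν : Measure M := ∑ k ∈ t, (chartVolume h k).restrict (U k)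
  have hle : riemannianVolume h ≤ ν := by
    refine iSup_le fun p ↦ Measure.le_iff.2 fun A hA ↦ ?_
    have hcov : A ⊆ ⋃ k ∈ t, A ∩ U k := fun x hx ↦ by
      obtain ⟨k, hk, hxk⟩ := Set.mem_iUnion₂.1 (ht (Set.mem_univ x))
      exact Set.mem_iUnion₂.2 ⟨k, hk, hx, hxk⟩
    calc chartVolume h p A ≤ chartVolume h p (⋃ k ∈ t, A ∩ U k) := measure_mono hcov
      _ ≤ ∑ k ∈ t, chartVolume h p (A ∩ U k) := measure_biUnion_finset_le _ _
      _ ≤ ∑ k ∈ t, chartVolume h k (A ∩ U k) := Finset.sum_le_sum fun k _ ↦ by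
          have hm := hA.inter (hUo k).measurableSet
          rw [← chartVolume_inter_source h p hm, chartVolume_eq_of_subset h
            (hm.inter (isOpen_extChartAt_source p).measurableSet) Set.inter_subset_right
            (Set.inter_subset_left.trans (Set.inter_subset_right.trans (hUs k)))]
          exact measure_mono Set.inter_subset_left
      _ = ν A := by
          simp only [ν, Measure.finsetSum_apply, Measure.restrict_apply hA]
  refine ⟨(hle _).trans_lt ?_⟩
  simp only [ν, Measure.finsetSum_apply, Measure.restrict_apply MeasurableSet.univ, Set.univ_inter]
  exact ENNReal.sum_lt_top.2 fun k _ ↦ hUf k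

theorem riemannianVolume_pos_of_isOpen (h : SmoothMetric I M) {U : Set M} (hU : IsOpen U)
    (hne : U.Nonempty) : 0 < riemannianVolume h U := by
  obtain ⟨p, hp⟩ := hne
  refine lt_of_lt_of_le ?_ (le_iSup (fun p ↦ chartVolume h p) p U)
  rw [chartVolume_apply h p hU.measurableSet, Set.inter_comm]
  have ho : IsOpen ((extChartAt I p).target ∩ (extChartAt I p).symm ⁻¹' U) :=
    (continuousOn_extChartAt_symm p).isOpen_inter_preimage (isOpen_extChartAt_target p) hU
  have hne : ((extChartAt I p).target ∩ (extChartAt I p).symm ⁻¹' U).Nonempty :=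
    ⟨extChartAt I p p, mem_extChartAt_target p, by simpa using hp⟩
  rw [pos_iff_ne_zero]
  intro h0
  rw [lintegral_eq_zero_iff' (((continuousOn_chartDensity h p).mono
    Set.inter_subset_left).aemeasurable ho.measurableSet)] at h0
  have h1 := (ae_restrict_iff' ho.measurableSet).1 h0
  have h2 : (Module.finBasis ℝ E).addHaar
      ((extChartAt I p).target ∩ (extChartAt I p).symm ⁻¹' U) = 0 := by
    refine measure_mono_null (fun y hy ↦ ?_) h1
    intro h3
    exact (chartDensity_pos h hy.1).ne' (h3 hy)
  exact (ho.measure_pos _ hne).ne' h2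

theorem riemannianVolume_le_smul {h h' : SmoothMetric I M} {c : ℝ} (hc : 0 ≤ c)
    (hle : ∀ p : M, ∀ y ∈ (extChartAt I p).target,
      gramDet (metricInChart h p y) ≤ c ^ 2 * gramDet (metricInChart h' p y)) :
    riemannianVolume h ≤ ENNReal.ofReal c • riemannianVolume h' := by
  refine iSup_le fun p ↦ Measure.le_iff.2 fun A hA ↦ ?_
  have h1 : chartVolume h p A ≤ ENNReal.ofReal c * chartVolume h' p A := by
    rw [chartVolume_apply h p hA, chartVolume_apply h' p hA,
      ← lintegral_const_mul' _ _ ENNReal.ofReal_ne_top]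
    refine setLIntegral_mono' (measurableSet_symm_preimage_inter_target p hA) fun y hy ↦ ?_
    rw [chartDensity, chartDensity, ← ENNReal.ofReal_mul hc]
    refine ENNReal.ofReal_le_ofReal ?_
    calc _ ≤ √(c ^ 2 * gramDet (metricInChart h' p y)) := Real.sqrt_le_sqrt (hle p y hy.2)
      _ = _ := by rw [Real.sqrt_mul (sq_nonneg c), Real.sqrt_sq hc]
  refine h1.trans ?_
  rw [Measure.smul_apply, smul_eq_mul]
  exact mul_le_mul_right (le_iSup (fun p ↦ chartVolume h' p) p A) _

end Volume

theorem isVonNBounded_of_pos {E : Type*} [NormedAddCommGroup E] [NormedSpace ℝ E]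
    [FiniteDimensional ℝ E] {A : E →L[ℝ] E →L[ℝ] ℝ} (hs : ∀ v w, A v w = A w v)
    (hp : ∀ v, v ≠ 0 → 0 < A v v) : Bornology.IsVonNBounded ℝ {v : E | A v v < 1} := by
  obtain ⟨e, he⟩ := exists_orthonormal_basis hs hp
  rw [NormedSpace.isVonNBounded_iff]
  have hc : Continuous e.equivFun.symm := e.equivFun.symm.toLinearMap.continuous_of_finiteDimensional
  refine ((isCompact_closedBall (0 : Fin (Module.finrank ℝ E) → ℝ) 1).image hc).isBounded.subset ?_
  intro v hv
  have h1 : A v v = ∑ k, e.repr v k ^ 2 := by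
    have hr (k) : e.repr v k = A v (e k) := by
      conv_rhs => rw [← e.sum_repr v]
      simp only [map_sum, _root_.sum_apply, map_smul, _root_.smul_apply, he]
      simp
    conv_lhs => enter [2]; rw [← e.sum_repr v]
    simp only [map_sum, map_smul, smul_eq_mul, ← hr, sq]
  refine ⟨e.equivFun v, ?_, by simp⟩
  rw [mem_closedBall_zero_iff, pi_norm_le_iff_of_nonneg zero_le_one]
  intro k
  rw [Real.norm_eq_abs, ← sq_le_one_iff_abs_le_one]
  have h2 : e.repr v k ^ 2 ≤ ∑ k, e.repr v k ^ 2 :=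
    Finset.single_le_sum (f := fun k ↦ e.repr v k ^ 2) (fun _ _ ↦ sq_nonneg _) (Finset.mem_univ k)
  exact h2.trans (h1 ▸ (show A v v < 1 from hv).le)

section PiManifold

variable {ι : Type*} [Fintype ι] {E : ι → Type*} [∀ i, NormedAddCommGroup (E i)]
  [∀ i, NormedSpace ℝ (E i)] {H : ι → Type*} [∀ i, TopologicalSpace (H i)]
  {I : ∀ i, ModelWithCorners ℝ (E i) (H i)}
  {M : ι → Type*} [∀ i, TopologicalSpace (M i)] [∀ i, ChartedSpace (H i) (M i)]

instance ModelWithCorners.boundaryless_pi [∀ i, (I i).Boundaryless] :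
    (ModelWithCorners.pi I).Boundaryless := by
  constructor
  refine Set.eq_univ_of_forall fun y ↦ ?_
  have h (i) : ∃ x, I i x = y i := by
    have : y i ∈ Set.range (I i) := by rw [(I i).range_eq_univ]; trivial
    exact this
  choose x hx using h
  exact ⟨x, funext hx⟩

theorem extChartAt_pi_symm_apply (q : ∀ i, M i) (y : ∀ i, E i) (i : ι) :
    (extChartAt (ModelWithCorners.pi I) q).symm y i = (extChartAt (I i) (q i)).symm (y i) := rfl

theorem mem_extChartAt_pi_source {q x : ∀ i, M i} :
    x ∈ (extChartAt (ModelWithCorners.pi I) q).source ↔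
      ∀ i, x i ∈ (extChartAt (I i) (q i)).source := by
  simp only [extChartAt_source, piChartedSpace_chartAt]
  simp

theorem mem_extChartAt_pi_target {q : ∀ i, M i} {y : ∀ i, E i} :
    y ∈ (extChartAt (ModelWithCorners.pi I) q).target ↔
      ∀ i, y i ∈ (extChartAt (I i) (q i)).target := by
  constructor
  · intro hy i
    have h1 := mem_extChartAt_pi_source.1 ((extChartAt (ModelWithCorners.pi I) q).map_target hy) i
    have h2 := congrFun ((extChartAt (ModelWithCorners.pi I) q).right_inv hy) i
    rw [← h2]
    exact (extChartAt (I i) (q i)).map_source h1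
  · intro hy
    have h1 : y = extChartAt (ModelWithCorners.pi I) q
        ((extChartAt (ModelWithCorners.pi I) q).symm y) :=
      funext fun i ↦ ((extChartAt (I i) (q i)).right_inv (hy i)).symm
    rw [h1]
    exact (extChartAt (ModelWithCorners.pi I) q).map_source
      (mem_extChartAt_pi_source.2 fun i ↦ (extChartAt (I i) (q i)).map_target (hy i))

section MultiInner

variable [∀ i, IsManifold (I i) ∞ (M i)]

/-- The bilinear form `∑ fᵢ² gᵢ` on the tangent spaces of a product manifold. -/
def multiInner (g : ∀ i, SmoothMetric (I i) (M i)) (f : ι → (∀ i, M i) → ℝ) (x : ∀ i, M i) :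
    (∀ i, E i) →L[ℝ] (∀ i, E i) →L[ℝ] ℝ :=
  ∑ i, f i x ^ 2 • ((ContinuousLinearMap.precomp ℝ (.proj i)) ∘L
    ((g i).inner (x i) : E i →L[ℝ] E i →L[ℝ] ℝ) ∘L (.proj i))

theorem multiInner_apply (g : ∀ i, SmoothMetric (I i) (M i)) (f : ι → (∀ i, M i) → ℝ)
    (x : ∀ i, M i) (v w : ∀ i, E i) :
    multiInner g f x v w = ∑ i, f i x ^ 2 * (g i).inner (x i) (v i) (w i) := by
  simp [multiInner]
  rfl

theorem multiInner_symm (g : ∀ i, SmoothMetric (I i) (M i)) (f : ι → (∀ i, M i) → ℝ)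
    (x : ∀ i, M i) (v w : ∀ i, E i) : multiInner g f x v w = multiInner g f x w v := by
  rw [multiInner_apply, multiInner_apply]
  exact Finset.sum_congr rfl fun i _ ↦ congrArg (f i x ^ 2 * ·) ((g i).symm (x i) (v i) (w i))

theorem multiInner_pos (g : ∀ i, SmoothMetric (I i) (M i)) {f : ι → (∀ i, M i) → ℝ}
    (hpos : ∀ i x, 0 < f i x) (x : ∀ i, M i) (v : ∀ i, E i) (hv : v ≠ 0) :
    0 < multiInner g f x v v := by
  rw [multiInner_apply]
  obtain ⟨i, hi⟩ := Function.ne_iff.1 hv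
  refine Finset.sum_pos' (fun j _ ↦ ?_) ⟨i, Finset.mem_univ i, ?_⟩
  · by_cases hj : v j = 0
    · rw [hj]
      exact (mul_zero _).symm.le.trans_eq (congrArg _ (map_zero ((g j).inner (x j) 0)).symm)
    · exact (mul_pos (pow_pos (hpos j x) 2) ((g j).pos _ _ hj)).le
  · exact mul_pos (pow_pos (hpos i x) 2) ((g i).pos _ _ hi)

end MultiInner

variable [∀ i, (I i).Boundaryless]

theorem writtenInExtChartAt_eval (i : ι) (q : ∀ i, M i) :
    writtenInExtChartAt (ModelWithCorners.pi I) (I i) q (fun x : ∀ i, M i ↦ x i)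
      =ᶠ[𝓝 (extChartAt (ModelWithCorners.pi I) q q)] fun y ↦ y i := by
  filter_upwards [extChartAt_target_mem_nhds (I := ModelWithCorners.pi I) q] with y hy
  exact (extChartAt (I i) (q i)).right_inv (mem_extChartAt_pi_target.1 hy i)

theorem contMDiff_eval (i : ι) :
    ContMDiff (ModelWithCorners.pi I) (I i) ∞ (fun x : ∀ i, M i ↦ x i) := by
  intro q
  rw [contMDiffAt_iff]
  refine ⟨(continuous_apply i).continuousAt, ?_⟩
  refine ContDiffAt.contDiffWithinAt ?_
  exact ((ContinuousLinearMap.proj (R := ℝ) (φ := E) i).contDiff.contDiffAt).congr_of_eventuallyEq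
    (writtenInExtChartAt_eval i q)

theorem mfderiv_eval (i : ι) (q : ∀ i, M i) :
    mfderiv (ModelWithCorners.pi I) (I i) (fun x : ∀ i, M i ↦ x i) q =
      (ContinuousLinearMap.proj (R := ℝ) (φ := E) i : (∀ i, E i) →L[ℝ] E i) := by
  refine HasMFDerivAt.mfderiv ⟨(continuous_apply i).continuousAt, ?_⟩
  exact ((ContinuousLinearMap.proj (R := ℝ) (φ := E) i).hasFDerivAt.congr_of_eventuallyEq
    (writtenInExtChartAt_eval i q)).hasFDerivWithinAt

variable [∀ i, IsManifold (I i) ∞ (M i)]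

theorem mfderiv_extChartAt_pi_symm {q : ∀ i, M i} {y : ∀ i, E i}
    (hy : y ∈ (extChartAt (ModelWithCorners.pi I) q).target) (v : ∀ i, E i) (i : ι) :
    mfderiv (ModelWithCorners.pi I) (I i) (fun x : ∀ i, M i ↦ x i)
      ((extChartAt (ModelWithCorners.pi I) q).symm y)
      (mfderiv 𝓘(ℝ, ∀ i, E i) (ModelWithCorners.pi I)
        (extChartAt (ModelWithCorners.pi I) q).symm y v) =
      mfderiv 𝓘(ℝ, E i) (I i) (extChartAt (I i) (q i)).symm (y i) (v i) := by
  have h1 : mfderiv 𝓘(ℝ, ∀ i, E i) (I i) ((fun x : ∀ i, M i ↦ x i) ∘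
      (extChartAt (ModelWithCorners.pi I) q).symm) y = _ :=
    mfderiv_comp y ((contMDiff_eval i).mdifferentiableAt (by simp))
      (mdifferentiableAt_extChartAt_symm hy)
  have h2 : mfderiv 𝓘(ℝ, ∀ i, E i) (I i) ((extChartAt (I i) (q i)).symm ∘
      (fun z : ∀ i, E i ↦ z i)) y = _ :=
    mfderiv_comp (I' := 𝓘(ℝ, E i)) y
      (mdifferentiableAt_extChartAt_symm (mem_extChartAt_pi_target.1 hy i))
      (hasFDerivAt_apply i y).differentiableAt.mdifferentiableAt
  have h3 := congrArg (fun A : (∀ i, E i) →L[ℝ] E i ↦ A v) (h1.symm.trans h2)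
  rw [mfderiv_eq_fderiv, (hasFDerivAt_apply i y).fderiv] at h3
  exact h3

theorem contMDiffAt_eval_symmL (i : ι) (q : ∀ i, M i) (v : ∀ i, E i) :
    ContMDiffAt (ModelWithCorners.pi I) ((I i).prod 𝓘(ℝ, E i)) ∞
      (fun x : ∀ i, M i ↦ Bundle.TotalSpace.mk' (E i) (E := TangentSpace (I i)) (x i)
        ((trivializationAt (∀ i, E i) (TangentSpace (ModelWithCorners.pi I)) q).symmL ℝ x v i)) q := by
  have h1 := (contMDiff_eval (M := M) (I := I) i).contMDiff_tangentMap (m := ∞) le_rfl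
  have h2 := (h1 _).comp q (contMDiffAt_symmL_trivializationAt (I := ModelWithCorners.pi I)
    (mem_chart_source _ q) v)
  refine h2.congr_of_eventuallyEq (Eventually.of_forall fun x ↦ ?_)
  simp only [Function.comp_apply, tangentMap, mfderiv_eval]
  rfl

theorem contMDiffAt_inner_symmL (g : ∀ i, SmoothMetric (I i) (M i)) (i : ι) (q : ∀ i, M i)
    (v w : ∀ i, E i) : ContMDiffAt (ModelWithCorners.pi I) 𝓘(ℝ, ℝ) ∞
      (fun x : ∀ i, M i ↦ (g i).inner (x i)
        ((trivializationAt (∀ i, E i) (TangentSpace (ModelWithCorners.pi I)) q).symmL ℝ x v i)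
        ((trivializationAt (∀ i, E i) (TangentSpace (ModelWithCorners.pi I)) q).symmL ℝ x w i))
      q := by
  have h1 : ContMDiffAt (ModelWithCorners.pi I) ((I i).prod 𝓘(ℝ)) ∞
      (fun x : ∀ i, M i ↦ Bundle.TotalSpace.mk' ℝ (E := Bundle.Trivial (M i) ℝ) (x i)
        ((g i).inner (x i)
        ((trivializationAt (∀ i, E i) (TangentSpace (ModelWithCorners.pi I)) q).symmL ℝ x v i)
        ((trivializationAt (∀ i, E i) (TangentSpace (ModelWithCorners.pi I)) q).symmL ℝ x w i)))
      q := by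
    apply ContMDiffAt.clm_bundle_apply₂ (F₁ := E i) (F₂ := E i)
    · exact (g i).contMDiff.contMDiffAt.comp q (contMDiff_eval i q)
    · exact contMDiffAt_eval_symmL i q v
    · exact contMDiffAt_eval_symmL i q w
  rw [Bundle.contMDiffAt_totalSpace] at h1
  exact h1.2

variable [∀ i, FiniteDimensional ℝ (E i)]

/-- The metric `∑ fᵢ² gᵢ` on a product manifold. -/
def multiMetric (g : ∀ i, SmoothMetric (I i) (M i)) (f : ι → (∀ i, M i) → ℝ)
    (hf : ∀ i, ContMDiff (ModelWithCorners.pi I) 𝓘(ℝ, ℝ) ∞ (f i)) (hpos : ∀ i x, 0 < f i x) :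
    SmoothMetric (ModelWithCorners.pi I) (∀ i, M i) where
  inner x := multiInner g f x
  symm x v w := multiInner_symm g f x v w
  pos x v hv := multiInner_pos g hpos x v hv
  isVonNBounded x := isVonNBounded_of_pos (multiInner_symm g f x) fun v hv ↦
    multiInner_pos g hpos x v hv
  contMDiff := by
    refine contMDiff_bilinear_section fun q v w ↦ ?_
    have h1 : ContMDiffAt (ModelWithCorners.pi I) 𝓘(ℝ, ℝ) ∞ (fun x : ∀ i, M i ↦
        ∑ i, f i x ^ 2 * (g i).inner (x i)
        ((trivializationAt (∀ i, E i) (TangentSpace (ModelWithCorners.pi I)) q).symmL ℝ x v i)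
        ((trivializationAt (∀ i, E i) (TangentSpace (ModelWithCorners.pi I)) q).symmL ℝ x w i))
        q :=
      ContMDiffAt.sum fun i _ ↦ ((hf i q).pow 2).mul (contMDiffAt_inner_symmL g i q v w)
    exact h1.congr_of_eventuallyEq (Eventually.of_forall fun x ↦ multiInner_apply g f x _ _)

theorem multiMetric_mem_multiconformalClass (g : ∀ i, SmoothMetric (I i) (M i))
    {f : ι → (∀ i, M i) → ℝ} (hf : ∀ i, ContMDiff (ModelWithCorners.pi I) 𝓘(ℝ, ℝ) ∞ (f i))
    (hpos : ∀ i x, 0 < f i x) : multiMetric g f hf hpos ∈ multiconformalClass g := by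
  refine ⟨f, hf, hpos, fun x v w ↦ ?_⟩
  simp only [mfderiv_eval]
  exact multiInner_apply g f x v w

theorem metricInChart_multiMetric (g : ∀ i, SmoothMetric (I i) (M i))
    {f : ι → (∀ i, M i) → ℝ} (hf : ∀ i, ContMDiff (ModelWithCorners.pi I) 𝓘(ℝ, ℝ) ∞ (f i))
    (hpos : ∀ i x, 0 < f i x) {q : ∀ i, M i} {y : ∀ i, E i}
    (hy : y ∈ (extChartAt (ModelWithCorners.pi I) q).target) (v w : ∀ i, E i) :
    metricInChart (multiMetric g f hf hpos) q y v w =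
      ∑ i, f i ((extChartAt (ModelWithCorners.pi I) q).symm y) ^ 2 *
        metricInChart (g i) (q i) (y i) (v i) (w i) := by
  have h1 (v : ∀ i, E i) (i : ι) := mfderiv_extChartAt_pi_symm hy v i
  simp only [mfderiv_eval] at h1
  refine (multiInner_apply g f _ _ _).trans (Finset.sum_congr rfl fun i _ ↦ ?_)
  exact congrArg (f i ((extChartAt (ModelWithCorners.pi I) q).symm y) ^ 2 * ·)
    (congrArg₂ (fun a b : E i ↦ (g i).inner ((extChartAt (I i) (q i)).symm (y i)) a b)
      (h1 v i) (h1 w i))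

end PiManifold

theorem coordScalarCurvature_congr {E : Type*} [NormedAddCommGroup E] [NormedSpace ℝ E]
    [FiniteDimensional ℝ E] {G G' : E → E →L[ℝ] E →L[ℝ] ℝ} {y : E} (hG : IsCoordMetric G y)
    (h : G' =ᶠ[𝓝 y] G) : coordScalarCurvature G' y = coordScalarCurvature G y := by
  have h1 : IsPullbackAt id G G' y := by
    filter_upwards [h] with z hz v w
    simp [hz]
  refine h1.coordScalarCurvature_eq (isCoordDiffeo_of_contDiff contDiff_id ?_) hG
  rw [fderiv_id]
  exact ContinuousLinearMap.isInvertible_equiv (f := ContinuousLinearEquiv.refl ℝ E)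

theorem IsCoordMetric.apply_inverse_nonneg {E : Type*} [NormedAddCommGroup E] [NormedSpace ℝ E]
    [FiniteDimensional ℝ E] {G : E → E →L[ℝ] E →L[ℝ] ℝ} {y : E} (hG : IsCoordMetric G y)
    (α : E →L[ℝ] ℝ) : 0 ≤ α ((G y).inverse α) := by
  have h1 : G y ((G y).inverse α) = α := hG.isInvertible.self_apply_inverse α
  by_cases h : (G y).inverse α = 0
  · rw [h, map_zero]
  · calc (0 : ℝ) ≤ G y ((G y).inverse α) ((G y).inverse α) := (hG.pos h).le
      _ = _ := by rw [h1]

theorem IsCoordMetric.apply_inverse_pos {E : Type*} [NormedAddCommGroup E] [NormedSpace ℝ E]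
    [FiniteDimensional ℝ E] {G : E → E →L[ℝ] E →L[ℝ] ℝ} {y : E} (hG : IsCoordMetric G y)
    {α : E →L[ℝ] ℝ} (hα : α ≠ 0) : 0 < α ((G y).inverse α) := by
  have h1 : G y ((G y).inverse α) = α := hG.isInvertible.self_apply_inverse α
  have h : (G y).inverse α ≠ 0 := fun h ↦ hα (by rw [← h1, h, map_zero])
  calc (0 : ℝ) < G y ((G y).inverse α) ((G y).inverse α) := hG.pos h
    _ = _ := by rw [h1]

theorem LinearMap.det_pi_smul {ι : Type*} [Fintype ι] {E : ι → Type*}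
    [∀ i, NormedAddCommGroup (E i)] [∀ i, NormedSpace ℝ (E i)] [∀ i, FiniteDimensional ℝ (E i)]
    (c : ι → ℝ) : LinearMap.det (LinearMap.pi fun i ↦ c i • LinearMap.proj i :
      (∀ i, E i) →ₗ[ℝ] ∀ i, E i) = ∏ i, c i ^ Module.finrank ℝ (E i) := by
  classical
  let b := Pi.basis fun i ↦ Module.finBasis ℝ (E i)
  have h1 : LinearMap.toMatrix b b (LinearMap.pi fun i ↦ c i • LinearMap.proj i) =
      Matrix.diagonal fun k ↦ c k.1 := by
    ext j k
    rw [LinearMap.toMatrix_apply]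
    have : (LinearMap.pi fun i ↦ c i • LinearMap.proj i : (∀ i, E i) →ₗ[ℝ] ∀ i, E i) (b k) =
        c k.1 • b k := by
      ext i
      by_cases h : i = k.1
      · subst h; simp
      · simp [b, Pi.basis_apply, h]
    rw [this, map_smul, Finsupp.smul_apply, b.repr_self, Matrix.diagonal_apply,
      Finsupp.single_apply]
    by_cases h : j = k
    · subst h; simp
    · simp [h, Ne.symm h]
  rw [← LinearMap.det_toMatrix b, h1, Matrix.det_diagonal, Fintype.prod_sigma]
  simp

section Estimate

variable {E : Type*} [NormedAddCommGroup E] [NormedSpace ℝ E] [FiniteDimensional ℝ E]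
  [MeasurableSpace E] [BorelSpace E]
  {H : Type*} [TopologicalSpace H] {I : ModelWithCorners ℝ E H} [I.Boundaryless]
  {M : Type*} [TopologicalSpace M] [ChartedSpace H M] [IsManifold I ∞ M] [CompactSpace M]
  [MeasurableSpace M] [BorelSpace M]

theorem einsteinHilbert_le {h h₀ : SmoothMetric I M} {D : M → ℝ} {K a t : ℝ} (hK : 0 < K)
    (hM : Nonempty M) (hd : 2 ≤ Module.finrank ℝ E)
    (h1 : riemannianVolume h ≤ ENNReal.ofReal K • riemannianVolume h₀)
    (h2 : riemannianVolume h₀ ≤ ENNReal.ofReal K • riemannianVolume h)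
    (hD : Continuous D) (hD0 : ∀ x, 0 ≤ D x) (ha : 0 ≤ a)
    (hR : ∀ x, scalarCurvature h x ≤ a - D x)
    (ht : t = 2 / (2 * (Module.finrank ℝ E : ℝ) / ((Module.finrank ℝ E : ℝ) - 2)))
    (hneg : a * (K * (riemannianVolume h₀).real Set.univ)
      - (∫ x, D x ∂(riemannianVolume h₀)) / K ≤ 0) :
    einsteinHilbert h ≤ (a * (K * (riemannianVolume h₀).real Set.univ)
      - (∫ x, D x ∂(riemannianVolume h₀)) / K) /
        (K * (riemannianVolume h₀).real Set.univ) ^ t := by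
  have := isFiniteMeasure_riemannianVolume h
  have := isFiniteMeasure_riemannianVolume h₀
  have hi {ν : Measure M} [IsFiniteMeasure ν] {F : M → ℝ} (hF : Continuous F) : Integrable F ν := by
    obtain ⟨C, hC⟩ := isCompact_univ.exists_bound_of_continuousOn hF.continuousOn
    exact Integrable.of_bound hF.aestronglyMeasurable C (ae_of_all _ fun x ↦ hC x (Set.mem_univ x))
  have hV : (riemannianVolume h).real Set.univ ≤ K * (riemannianVolume h₀).real Set.univ := by
    have := ENNReal.toReal_mono (ENNReal.mul_ne_top ENNReal.ofReal_ne_top (measure_ne_top _ _))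
      (h1 Set.univ)
    simpa [Measure.real, ENNReal.toReal_mul, ENNReal.toReal_ofReal hK.le] using this
  have hV0 : 0 < (riemannianVolume h).real Set.univ :=
    ENNReal.toReal_pos (riemannianVolume_pos_of_isOpen h isOpen_univ Set.univ_nonempty).ne'
      (measure_ne_top _ _)
  have hint : ∫ x, D x ∂(riemannianVolume h₀) ≤ K * ∫ x, D x ∂(riemannianVolume h) := by
    have h3 := integral_mono_measure h2 (ae_of_all _ hD0)
      ((hi (ν := riemannianVolume h) hD).smul_measure ENNReal.ofReal_ne_top)
    rwa [integral_smul_measure, ENNReal.toReal_ofReal hK.le, smul_eq_mul] at h3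
  have hnum : ∫ x, scalarCurvature h x ∂(riemannianVolume h) ≤
      a * (K * (riemannianVolume h₀).real Set.univ) - (∫ x, D x ∂(riemannianVolume h₀)) / K := by
    calc _ ≤ ∫ x, (a - D x) ∂(riemannianVolume h) :=
          integral_mono (hi (continuous_scalarCurvature h)) (hi (by fun_prop)) hR
      _ = a * (riemannianVolume h).real Set.univ - ∫ x, D x ∂(riemannianVolume h) := by
          rw [integral_sub (hi continuous_const) (hi hD), integral_const, smul_eq_mul, mul_comm]
      _ ≤ _ := by
          have h4 : (∫ x, D x ∂(riemannianVolume h₀)) / K ≤ ∫ x, D x ∂(riemannianVolume h) :=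
            (div_le_iff₀' hK).2 hint
          have h6 := mul_le_mul_of_nonneg_left hV ha
          linarith
  have ht0 : 0 ≤ t := by
    have : (2 : ℝ) ≤ Module.finrank ℝ E := by exact_mod_cast hd
    have : 0 ≤ (Module.finrank ℝ E : ℝ) - 2 := by linarith
    rw [ht]
    positivity
  rw [einsteinHilbert, ← ht]
  refine (div_le_div_of_nonneg_right hnum (by positivity)).trans ?_
  have h7 : 0 < (riemannianVolume h).real Set.univ ^ t := Real.rpow_pos_of_pos hV0 t
  have h8 := Real.rpow_le_rpow hV0.le hV ht0
  rw [div_le_div_iff₀ h7 (h7.trans_le h8)]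
  exact mul_le_mul_of_nonpos_left h8 hneg

end Estimate

section ExpMetric

variable {ι : Type*} [Fintype ι] {E : ι → Type*} [∀ i, NormedAddCommGroup (E i)]
  [∀ i, NormedSpace ℝ (E i)] [∀ i, FiniteDimensional ℝ (E i)]
  {H : ι → Type*} [∀ i, TopologicalSpace (H i)]
  {I : ∀ i, ModelWithCorners ℝ (E i) (H i)} [∀ i, (I i).Boundaryless]
  {M : ι → Type*} [∀ i, TopologicalSpace (M i)] [∀ i, ChartedSpace (H i) (M i)]
  [∀ i, IsManifold (I i) ∞ (M i)]
  (g : ∀ i, SmoothMetric (I i) (M i)) (β : ι → ℝ) (o : ι) {u : M o → ℝ}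
  (hu : ContMDiff (I o) 𝓘(ℝ, ℝ) ∞ u)

/-- The multiconformal metric with the factors `exp (βᵢ u)`. -/
def expMetric : SmoothMetric (ModelWithCorners.pi I) (∀ i, M i) :=
  multiMetric g (fun i x ↦ Real.exp (β i * u (x o)))
    (fun _ ↦ Real.contDiff_exp.comp_contMDiff (contMDiff_const.mul (hu.comp (contMDiff_eval o))))
    fun _ _ ↦ Real.exp_pos _

theorem expMetric_mem : expMetric g β o hu ∈ multiconformalClass g :=
  multiMetric_mem_multiconformalClass _ _ _

theorem metricInChart_expMetric {q : ∀ i, M i} {y : ∀ i, E i}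
    (hy : y ∈ (extChartAt (ModelWithCorners.pi I) q).target) :
    metricInChart (expMetric g β o hu) q y = multiForm (fun i ↦ metricInChart (g i) (q i)) β o
      (u ∘ (extChartAt (I o) (q o)).symm) y := by
  ext v w
  rw [expMetric, metricInChart_multiMetric _ _ _ hy, multiForm_apply]
  refine Finset.sum_congr rfl fun i _ ↦ ?_
  rw [← Real.exp_nat_mul, extChartAt_pi_symm_apply]
  simp [mul_assoc]

variable {β o}

theorem scalarCurvature_expMetric (hβ : ∑ i, Module.finrank ℝ (E i) * β i = β o) {q x : ∀ i, M i}
    (hx : x ∈ (extChartAt (ModelWithCorners.pi I) q).source) :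
    scalarCurvature (expMetric g β o hu) x =
      ∑ i, Real.exp (-2 * β i * u (x o)) * scalarCurvature (g i) (x i)
      - (∑ i, Module.finrank ℝ (E i) * β i ^ 2 - β o ^ 2) * (Real.exp (-2 * β o * u (x o)) *
        fderiv ℝ (u ∘ (extChartAt (I o) (q o)).symm) (extChartAt (I o) (q o) (x o))
          ((metricInChart (g o) (q o) (extChartAt (I o) (q o) (x o))).inverse
            (fderiv ℝ (u ∘ (extChartAt (I o) (q o)).symm) (extChartAt (I o) (q o) (x o))))) := by
  have hxi := mem_extChartAt_pi_source.1 hx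
  have hy := (extChartAt (ModelWithCorners.pi I) q).map_source hx
  have hyi (i) := (extChartAt (I i) (q i)).map_source (hxi i)
  have hux : (u ∘ (extChartAt (I o) (q o)).symm) (extChartAt (I o) (q o) (x o)) = u (x o) :=
    congrArg u ((extChartAt (I o) (q o)).left_inv (hxi o))
  have hG (i) := isCoordMetric_metricInChart (g i) (q i) (hyi i)
  have hus : ∀ᶠ z in 𝓝 (extChartAt (I o) (q o) (x o)),
      ContDiffAt ℝ ∞ (u ∘ (extChartAt (I o) (q o)).symm) z := by
    filter_upwards [(isOpen_extChartAt_target (q o)).mem_nhds (hyi o)] with z hz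
    exact ((hu _).comp z (contMDiffAt_extChartAt_symm hz)).contDiffAt
  have hM := isCoordMetric_multiForm (β := β)
    (p := extChartAt (ModelWithCorners.pi I) q x) hG hus
  rw [scalarCurvature_eq_of_mem_source _ hx, coordScalarCurvature_congr hM]
  · refine (coordScalarCurvature_multiForm hG hus hβ).trans ?_
    simp only [hux, fun i ↦ scalarCurvature_eq_of_mem_source (g i) (hxi i)]
  · filter_upwards [(isOpen_extChartAt_target q).mem_nhds hy] with z hz
    exact metricInChart_expMetric g β o hu hz

theorem gramDet_metricInChart_expMetric (hβ : ∑ i, Module.finrank ℝ (E i) * β i = β o)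
    {q : ∀ i, M i} {y : ∀ i, E i} (hy : y ∈ (extChartAt (ModelWithCorners.pi I) q).target) :
    gramDet (metricInChart (expMetric g β o hu) q y) =
      Real.exp (β o * u ((extChartAt (I o) (q o)).symm (y o))) ^ 2 *
        gramDet (metricInChart (expMetric g β o (contMDiff_const (c := (0 : ℝ)))) q y) := by
  set s := u ((extChartAt (I o) (q o)).symm (y o)) with hs
  rw [gramDet_of_comp (LinearMap.pi fun i ↦ Real.exp (β i * s) • LinearMap.proj i :
    (∀ i, E i) →ₗ[ℝ] ∀ i, E i), LinearMap.det_pi_smul]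
  · congr 2
    simp only [← Real.exp_nat_mul, ← Real.exp_sum, ← hβ, Finset.sum_mul, mul_assoc]
  · intro v w
    rw [metricInChart_expMetric g β o hu hy, metricInChart_expMetric g β o _ hy,
      multiForm_apply, multiForm_apply]
    refine Finset.sum_congr rfl fun i _ ↦ ?_
    simp only [Function.comp_apply, ← hs, LinearMap.pi_apply, LinearMap.smul_apply,
      LinearMap.proj_apply, map_smul, _root_.smul_apply, smul_eq_mul, mul_zero, Real.exp_zero]
    rw [show 2 * β i * s = β i * s + β i * s by ring, Real.exp_add]
    ring

variable [∀ i, MeasurableSpace (E i)] [∀ i, BorelSpace (E i)]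
  [∀ i, MeasurableSpace (M i)] [BorelSpace (∀ i, M i)]

theorem riemannianVolume_expMetric_le (hβ : ∑ i, Module.finrank ℝ (E i) * β i = β o)
    (hu1 : ∀ x, |u x| ≤ 1) : riemannianVolume (expMetric g β o hu) ≤
      ENNReal.ofReal (Real.exp |β o|) •
        riemannianVolume (expMetric g β o (contMDiff_const (c := (0 : ℝ)))) := by
  refine riemannianVolume_le_smul (Real.exp_pos _).le fun q y hy ↦ ?_
  rw [gramDet_metricInChart_expMetric g hu hβ hy]
  gcongr
  · exact (gramDet_metricInChart_pos _ hy).le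
  · refine (le_abs_self _).trans ?_
    rw [abs_mul]
    exact mul_le_of_le_one_right (abs_nonneg _) (hu1 _)

theorem le_riemannianVolume_expMetric (hβ : ∑ i, Module.finrank ℝ (E i) * β i = β o)
    (hu1 : ∀ x, |u x| ≤ 1) : riemannianVolume (expMetric g β o (contMDiff_const (c := (0 : ℝ)))) ≤
      ENNReal.ofReal (Real.exp |β o|) • riemannianVolume (expMetric g β o hu) := by
  refine riemannianVolume_le_smul (Real.exp_pos _).le fun q y hy ↦ ?_
  rw [gramDet_metricInChart_expMetric g hu hβ hy, ← mul_assoc, ← mul_pow, ← Real.exp_add]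
  refine le_mul_of_one_le_left (gramDet_metricInChart_pos _ hy).le (one_le_pow₀ ?_)
  have h1 := neg_abs_le (β o * u ((extChartAt (I o) (q o)).symm (y o)))
  rw [abs_mul] at h1
  have h2 := mul_le_of_le_one_right (abs_nonneg (β o)) (hu1 ((extChartAt (I o) (q o)).symm (y o)))
  rw [Real.one_le_exp_iff]
  linarith

end ExpMetric

theorem exists_contMDiff_fderiv_ne_zero {E : Type*} [NormedAddCommGroup E] [NormedSpace ℝ E]
    [FiniteDimensional ℝ E] [Nontrivial E] {H : Type*} [TopologicalSpace H]
    {I : ModelWithCorners ℝ E H} [I.Boundaryless]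
    {M : Type*} [TopologicalSpace M] [ChartedSpace H M] [IsManifold I ∞ M] [T2Space M] (q : M) :
    ∃ φ : M → ℝ, ContMDiff I 𝓘(ℝ, ℝ) ∞ φ ∧
      fderiv ℝ (φ ∘ (extChartAt I q).symm) (extChartAt I q q) ≠ 0 := by
  obtain ⟨v, hv⟩ := exists_ne (0 : E)
  obtain ⟨α, -, hα⟩ := exists_dual_vector ℝ v (norm_ne_zero_iff.2 hv)
  obtain ⟨f⟩ : Nonempty (SmoothBumpFunction I q) := inferInstance
  refine ⟨fun x ↦ f x • α (extChartAt I q x), f.contMDiff_smul ?_, ?_⟩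
  · exact α.contDiff.contMDiff.comp_contMDiffOn contMDiffOn_extChartAt
  · have h1 : ((fun x ↦ f x • α (extChartAt I q x)) ∘ (extChartAt I q).symm)
        =ᶠ[𝓝 (extChartAt I q q)] α := by
      have h2 : Tendsto (extChartAt I q).symm (𝓝 (extChartAt I q q)) (𝓝 q) := by
        have h3 := continuousAt_extChartAt_symm (I := I) q
        rwa [ContinuousAt, extChartAt_to_inv] at h3
      filter_upwards [h2.eventually f.eventuallyEq_one, extChartAt_target_mem_nhds (I := I) q]
        with y hy hyt
      rw [Function.comp_apply, hy, (extChartAt I q).right_inv hyt, Pi.one_apply, one_smul]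
    rw [h1.fderiv_eq, α.fderiv]
    rintro rfl
    exact hv (norm_eq_zero.1 (by simpa using hα.symm))

section ChartGradSq

variable {E : Type*} [NormedAddCommGroup E] [NormedSpace ℝ E] {H : Type*} [TopologicalSpace H]
  {I : ModelWithCorners ℝ E H} {M : Type*} [TopologicalSpace M] [ChartedSpace H M]
  [IsManifold I ∞ M]

/-- The squared norm of the differential of a function, in the chart at `q`. -/
def chartGradSq (h : SmoothMetric I M) (u : M → ℝ) (q : M) (y : E) : ℝ :=
  fderiv ℝ (u ∘ (extChartAt I q).symm) y ((metricInChart h q y).inverse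
    (fderiv ℝ (u ∘ (extChartAt I q).symm) y))

variable [I.Boundaryless]

theorem chartGradSq_eq_of_hasDerivAt (h : SmoothMetric I M) {φ : M → ℝ} (hφ : ContMDiff I 𝓘(ℝ, ℝ) ∞ φ)
    {σ : ℝ → ℝ} {σ' : ℝ} {q : M}
    {y : E} (hy : y ∈ (extChartAt I q).target)
    (hσ : HasDerivAt σ σ' (φ ((extChartAt I q).symm y))) :
    chartGradSq h (fun x ↦ σ (φ x)) q y = σ' ^ 2 * chartGradSq h φ q y := by
  have h1 : DifferentiableAt ℝ (φ ∘ (extChartAt I q).symm) y :=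
    ((hφ _).comp y (contMDiffAt_extChartAt_symm hy)).contDiffAt.differentiableAt (by simp)
  have h2 : fderiv ℝ ((fun x ↦ σ (φ x)) ∘ (extChartAt I q).symm) y =
      σ' • fderiv ℝ (φ ∘ (extChartAt I q).symm) y :=
    (hσ.comp_hasFDerivAt y h1.hasFDerivAt).fderiv
  rw [chartGradSq, h2, chartGradSq]
  simp only [map_smul, _root_.smul_apply, smul_eq_mul]
  ring

theorem exists_chartGradSq_gt [FiniteDimensional ℝ E] [Nontrivial E] [T2Space M]
    (h : SmoothMetric I M) (q : M) :
    ∃ φ : M → ℝ, ContMDiff I 𝓘(ℝ, ℝ) ∞ φ ∧ ∃ κ > 0, ∀ᶠ x in 𝓝 q,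
      κ < chartGradSq h φ q (extChartAt I q x) := by
  obtain ⟨φ, hφ, h0⟩ := exists_contMDiff_fderiv_ne_zero (I := I) q
  have hm := isCoordMetric_metricInChart h q (mem_extChartAt_target (I := I) q)
  have h1 : 0 < chartGradSq h φ q (extChartAt I q q) := hm.apply_inverse_pos h0
  refine ⟨φ, hφ, _, half_pos h1, ?_⟩
  have h2 : ContinuousAt (fderiv ℝ (φ ∘ (extChartAt I q).symm)) (extChartAt I q q) :=
    (((hφ _).comp _ (contMDiffAt_extChartAt_symm
      (mem_extChartAt_target (I := I) q))).contDiffAt.fderiv_right (m := ∞) le_rfl).continuousAt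
  have h3 : ContinuousAt (chartGradSq h φ q) (extChartAt I q q) :=
    h2.clm_apply ((hm.contDiffAt_inverse.continuousAt).clm_apply h2)
  have h4 := ContinuousAt.comp (g := chartGradSq h φ q) h3 (continuousAt_extChartAt (I := I) q)
  exact h4.eventually_const_lt (half_lt_self h1)

end ChartGradSq

section Oscillation

variable {ι : Type*} [Fintype ι] {E : ι → Type*} [∀ i, NormedAddCommGroup (E i)]
  [∀ i, NormedSpace ℝ (E i)] [∀ i, FiniteDimensional ℝ (E i)]
  {H : ι → Type*} [∀ i, TopologicalSpace (H i)]
  {I : ∀ i, ModelWithCorners ℝ (E i) (H i)} [∀ i, (I i).Boundaryless]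
  {M : ι → Type*} [∀ i, TopologicalSpace (M i)] [∀ i, ChartedSpace (H i) (M i)]
  [∀ i, IsManifold (I i) ∞ (M i)]
  (g : ∀ i, SmoothMetric (I i) (M i)) (β : ι → ℝ) (o : ι) {u : M o → ℝ}
  (hu : ContMDiff (I o) 𝓘(ℝ, ℝ) ∞ u)

/-- The part of the scalar curvature of `expMetric` which is quadratic in the differential of the
function `u`, with the opposite sign. -/
def gradientTerm (x : ∀ i, M i) : ℝ :=
  ∑ i, Real.exp (-2 * β i * u (x o)) * scalarCurvature (g i) (x i)
    - scalarCurvature (expMetric g β o hu) x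

theorem continuous_gradientTerm : Continuous (gradientTerm g β o hu) := by
  have h1 := hu.continuous
  have h2 (i) := continuous_scalarCurvature (g i)
  have h3 := continuous_scalarCurvature (expMetric g β o hu)
  unfold gradientTerm
  fun_prop

variable {β o}

theorem gradientTerm_eq (hβ : ∑ i, Module.finrank ℝ (E i) * β i = β o) {q x : ∀ i, M i}
    (hx : x ∈ (extChartAt (ModelWithCorners.pi I) q).source) :
    gradientTerm g β o hu x = (∑ i, Module.finrank ℝ (E i) * β i ^ 2 - β o ^ 2) *
      (Real.exp (-2 * β o * u (x o)) *
        chartGradSq (g o) u (q o) (extChartAt (I o) (q o) (x o))) := by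
  rw [gradientTerm, scalarCurvature_expMetric g hu hβ hx, sub_sub_cancel]
  rfl

theorem chartGradSq_nonneg {q x : ∀ i, M i}
    (hx : x ∈ (extChartAt (ModelWithCorners.pi I) q).source) :
    0 ≤ chartGradSq (g o) u (q o) (extChartAt (I o) (q o) (x o)) :=
  (isCoordMetric_metricInChart (g o) (q o) ((extChartAt (I o) (q o)).map_source
    (mem_extChartAt_pi_source.1 hx o))).apply_inverse_nonneg _

theorem gradientTerm_nonneg (hβ : ∑ i, Module.finrank ℝ (E i) * β i = β o)
    (hQ : β o ^ 2 ≤ ∑ i, Module.finrank ℝ (E i) * β i ^ 2) (x : ∀ i, M i) :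
    0 ≤ gradientTerm g β o hu x := by
  rw [gradientTerm_eq g hu hβ (mem_extChartAt_source (I := ModelWithCorners.pi I) x)]
  exact mul_nonneg (sub_nonneg.2 hQ) (mul_nonneg (Real.exp_pos _).le
    (chartGradSq_nonneg g (mem_extChartAt_source (I := ModelWithCorners.pi I) x)))

theorem le_gradientTerm (hβ : ∑ i, Module.finrank ℝ (E i) * β i = β o)
    (hQ : β o ^ 2 ≤ ∑ i, Module.finrank ℝ (E i) * β i ^ 2) (hu1 : ∀ x, |u x| ≤ 1) {q x : ∀ i, M i}
    (hx : x ∈ (extChartAt (ModelWithCorners.pi I) q).source) :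
    (∑ i, Module.finrank ℝ (E i) * β i ^ 2 - β o ^ 2) * (Real.exp (-2 * |β o|) *
        chartGradSq (g o) u (q o) (extChartAt (I o) (q o) (x o))) ≤ gradientTerm g β o hu x := by
  rw [gradientTerm_eq g hu hβ hx]
  have h1 := le_abs_self (β o * u (x o))
  rw [abs_mul] at h1
  have h2 := mul_le_of_le_one_right (abs_nonneg (β o)) (hu1 (x o))
  refine mul_le_mul_of_nonneg_left (mul_le_mul_of_nonneg_right (Real.exp_le_exp.2 ?_)
    (chartGradSq_nonneg g hx)) (sub_nonneg.2 hQ)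
  linarith

theorem exists_scalarCurvature_expMetric_le [∀ i, CompactSpace (M i)] :
    ∃ a, 0 ≤ a ∧ ∀ (u : M o → ℝ) (hu : ContMDiff (I o) 𝓘(ℝ, ℝ) ∞ u), (∀ x, |u x| ≤ 1) →
      ∀ x, scalarCurvature (expMetric g β o hu) x ≤ a - gradientTerm g β o hu x := by
  have h1 (i) : ∃ C, ∀ x, ‖scalarCurvature (g i) x‖ ≤ C := by
    obtain ⟨C, hC⟩ := isCompact_univ.exists_bound_of_continuousOn
      (continuous_scalarCurvature (g i)).continuousOn
    exact ⟨C, fun x ↦ hC x (Set.mem_univ x)⟩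
  choose C hC using h1
  refine ⟨∑ i, Real.exp (2 * |β i|) * |C i|, by positivity, fun u hu hu1 x ↦ ?_⟩
  rw [gradientTerm, le_sub_iff_add_le, add_sub_cancel]
  refine Finset.sum_le_sum fun i _ ↦ (le_abs_self _).trans ?_
  rw [abs_mul, Real.abs_exp]
  have h1 := neg_abs_le (β i * u (x o))
  rw [abs_mul] at h1
  have h2 := mul_le_of_le_one_right (abs_nonneg (β i)) (hu1 (x o))
  exact mul_le_mul (Real.exp_le_exp.2 (by linarith)) ((hC i (x i)).trans (le_abs_self _))
    (abs_nonneg _) (Real.exp_pos _).le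

variable [∀ i, CompactSpace (M i)] [∀ i, MeasurableSpace (M i)] [BorelSpace (∀ i, M i)]

/-- Rapid oscillation makes the gradient term large. -/
theorem exists_le_integral_gradientTerm (hβ : ∑ i, Module.finrank ℝ (E i) * β i = β o)
    (hQ : β o ^ 2 < ∑ i, Module.finrank ℝ (E i) * β i ^ 2) [Nontrivial (E o)] [T2Space (M o)]
    [∀ i, Nonempty (M i)] (μ : Measure (∀ i, M i)) [IsFiniteMeasure μ] [μ.IsOpenPosMeasure]
    (B : ℝ) : ∃ (u : M o → ℝ) (hu : ContMDiff (I o) 𝓘(ℝ, ℝ) ∞ u), (∀ x, |u x| ≤ 1) ∧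
      B ≤ ∫ x, gradientTerm g β o hu x ∂μ := by
  let q : ∀ i, M i := fun i ↦ Classical.arbitrary (M i)
  obtain ⟨φ, hφ, κ, hκ, hev⟩ := exists_chartGradSq_gt (g o) (q o)
  obtain ⟨S, hS, hSo, hqS⟩ := mem_nhds_iff.1 (((continuous_apply o).continuousAt.eventually hev).and
    (extChartAt_source_mem_nhds (I := ModelWithCorners.pi I) q))
  set c := ∑ i, Module.finrank ℝ (E i) * β i ^ 2 - β o ^ 2 with hc_def
  have hc : 0 < c := sub_pos.2 hQ
  let δ := c * (Real.exp (-2 * |β o|) * κ)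
  have hδ : 0 < δ := by positivity
  have hVS : 0 < μ.real S := ENNReal.toReal_pos (hSo.measure_pos μ ⟨q, hqS⟩).ne' (measure_ne_top _ _)
  let n := Real.sqrt (2 * |B| / (δ * μ.real S))
  have hn : n ^ 2 = 2 * |B| / (δ * μ.real S) := Real.sq_sqrt (by positivity)
  have hs : ContMDiff (I o) 𝓘(ℝ, ℝ) ∞ fun x ↦ Real.sin (n * φ x) :=
    Real.contDiff_sin.comp_contMDiff (contMDiff_const.mul hφ)
  have hk : ContMDiff (I o) 𝓘(ℝ, ℝ) ∞ fun x ↦ Real.cos (n * φ x) :=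
    Real.contDiff_cos.comp_contMDiff (contMDiff_const.mul hφ)
  have hi {u : M o → ℝ} (hu : ContMDiff (I o) 𝓘(ℝ, ℝ) ∞ u) : Integrable (gradientTerm g β o hu) μ := by
    obtain ⟨C, hC⟩ := isCompact_univ.exists_bound_of_continuousOn
      (continuous_gradientTerm g β o hu).continuousOn
    exact Integrable.of_bound (continuous_gradientTerm g β o hu).aestronglyMeasurable C
      (ae_of_all _ fun x ↦ hC x (Set.mem_univ x))
  have hsum : 2 * |B| ≤ ∫ x, gradientTerm g β o hs x ∂μ + ∫ x, gradientTerm g β o hk x ∂μ := by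
    rw [← integral_add (hi hs) (hi hk)]
    calc 2 * |B| = ∫ x in S, δ * n ^ 2 ∂μ := by
          rw [setIntegral_const, smul_eq_mul, hn]; field_simp
      _ ≤ ∫ x in S, (gradientTerm g β o hs x + gradientTerm g β o hk x) ∂μ := by
          refine setIntegral_mono_on (integrable_const _).integrableOn ((hi hs).add (hi hk)).integrableOn
            hSo.measurableSet fun x hx ↦ ?_
          obtain ⟨h1, h2⟩ := hS hx
          have h3 := le_gradientTerm g hs hβ hQ.le (fun x ↦ Real.abs_sin_le_one _) h2
          have h4 := le_gradientTerm g hk hβ hQ.le (fun x ↦ Real.abs_cos_le_one _) h2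
          have hy := (extChartAt (I o) (q o)).map_source (mem_extChartAt_pi_source.1 h2 o)
          have e1 := chartGradSq_eq_of_hasDerivAt (g o) hφ hy
            (((hasDerivAt_id _).const_mul n).sin)
          have e2 := chartGradSq_eq_of_hasDerivAt (g o) hφ hy
            (((hasDerivAt_id _).const_mul n).cos)
          simp only [id_eq] at e1 e2
          rw [← hc_def] at h3 h4
          rw [e1] at h3
          rw [e2] at h4
          refine le_trans ?_ (add_le_add h3 h4)
          set N := chartGradSq (g o) φ (q o) (extChartAt (I o) (q o) (x o))
          set s := n * φ ((extChartAt (I o) (q o)).symm (extChartAt (I o) (q o) (x o)))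
          have h5 := Real.sin_sq_add_cos_sq s
          calc δ * n ^ 2 ≤ c * (Real.exp (-2 * |β o|) * N) * n ^ 2 := by
                simp only [δ]; gcongr
            _ = c * (Real.exp (-2 * |β o|) * N) * n ^ 2 * (Real.sin s ^ 2 + Real.cos s ^ 2) := by
                rw [h5, mul_one]
            _ = _ := by ring
      _ ≤ _ := setIntegral_le_integral ((hi hs).add (hi hk)) (ae_of_all _ fun x ↦
          add_nonneg (gradientTerm_nonneg g hs hβ hQ.le x) (gradientTerm_nonneg g hk hβ hQ.le x))
  have hB := le_abs_self B
  by_cases h : B ≤ ∫ x, gradientTerm g β o hs x ∂μ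
  · exact ⟨_, hs, fun x ↦ Real.abs_sin_le_one _, h⟩
  · exact ⟨_, hk, fun x ↦ Real.abs_cos_le_one _, by linarith⟩

theorem exists_einsteinHilbert_le (hβ : ∑ i, Module.finrank ℝ (E i) * β i = β o)
    (hQ : β o ^ 2 < ∑ i, Module.finrank ℝ (E i) * β i ^ 2) [Nontrivial (E o)] [T2Space (M o)]
    [∀ i, Nonempty (M i)] [∀ i, MeasurableSpace (E i)] [∀ i, BorelSpace (E i)]
    (hd : 2 ≤ Module.finrank ℝ (∀ i, E i)) (B : ℝ) :
    ∃ h ∈ multiconformalClass g, einsteinHilbert h ≤ B := by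
  let h₀ := expMetric g β o (contMDiff_const (c := (0 : ℝ)))
  let K := Real.exp |β o|
  have hK : 0 < K := Real.exp_pos _
  obtain ⟨a, ha, hR⟩ := exists_scalarCurvature_expMetric_le g (β := β) (o := o)
  have := isFiniteMeasure_riemannianVolume h₀
  have : (riemannianVolume h₀).IsOpenPosMeasure :=
    ⟨fun U hU hne ↦ (riemannianVolume_pos_of_isOpen h₀ hU hne).ne'⟩
  set V := K * (riemannianVolume h₀).real Set.univ with hV_def
  have hV : 0 < V := mul_pos hK (ENNReal.toReal_pos
    (riemannianVolume_pos_of_isOpen h₀ isOpen_univ Set.univ_nonempty).ne' (measure_ne_top _ _))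
  obtain ⟨t, ht⟩ : ∃ t : ℝ, t = 2 / (2 * (Module.finrank ℝ (∀ i, E i) : ℝ) /
    ((Module.finrank ℝ (∀ i, E i) : ℝ) - 2)) := ⟨_, rfl⟩
  have hVt : 0 < V ^ t := Real.rpow_pos_of_pos hV t
  obtain ⟨u, hu, hu1, hle⟩ := exists_le_integral_gradientTerm g hβ hQ (riemannianVolume h₀)
    (K * (a * V + |B| * V ^ t))
  have hle' := (le_div_iff₀' hK).2 hle
  have h0 := mul_nonneg (abs_nonneg B) hVt.le
  refine ⟨_, expMetric_mem g β o hu, (einsteinHilbert_le hK inferInstance hd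
    (riemannianVolume_expMetric_le g hu hβ hu1) (le_riemannianVolume_expMetric g hu hβ hu1)
    (continuous_gradientTerm g β o hu) (gradientTerm_nonneg g hu hβ hQ.le) ha (hR u hu hu1) ht
    (by linarith)).trans ?_⟩
  rw [div_le_iff₀ hVt]
  have h1 := mul_le_mul_of_nonneg_right (neg_abs_le B) hVt.le
  linarith

end Oscillation

/-- Exponents for which the gradient term has a positive coefficient. -/
theorem exists_exponents {ι : Type*} [Fintype ι] (m : ι → ℕ) (hm : ∀ i, 1 ≤ m i)
    (hι : 2 ≤ Fintype.card ι) (hdim : 3 ≤ ∑ i, m i) :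
    ∃ (β : ι → ℝ) (o : ι), ∑ i, m i * β i = β o ∧ β o ^ 2 < ∑ i, m i * β i ^ 2 := by
  classical
  by_cases h : ∃ o, 2 ≤ m o
  · obtain ⟨o, ho⟩ := h
    obtain ⟨j, hj⟩ := Fintype.exists_ne_of_one_lt_card hι o
    have hmj : (m j : ℝ) ≠ 0 := by have := hm j; positivity
    have ho' : (2 : ℝ) ≤ m o := by exact_mod_cast ho
    refine ⟨fun i ↦ (if i = o then 1 else 0) + if i = j then -((m o : ℝ) - 1) / m j else 0, o, ?_, ?_⟩
    · simp only [mul_add, Finset.sum_add_distrib, mul_ite, mul_one, mul_zero, Finset.sum_ite_eq',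
        Finset.mem_univ, if_true, if_neg hj.symm, add_zero]
      field_simp
      ring
    · have : ∀ i, (m i : ℝ) * ((if i = o then 1 else 0) + if i = j then -((m o : ℝ) - 1) / m j else 0) ^ 2
          = (if i = o then (m i : ℝ) else 0) +
            if i = j then (m i : ℝ) * (-((m o : ℝ) - 1) / m j) ^ 2 else 0 := by
        intro i
        by_cases h1 : i = o
        · subst h1; simp [hj.symm]
        · simp [h1, mul_ite]
      simp only [this, Finset.sum_add_distrib, Finset.sum_ite_eq', Finset.mem_univ, if_true,
        if_neg hj.symm, add_zero]
      have : 0 ≤ (m j : ℝ) * (-((m o : ℝ) - 1) / m j) ^ 2 := by positivity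
      linarith
  · push Not at h
    have h1 (i) : m i = 1 := le_antisymm (by have := h i; omega) (hm i)
    simp only [h1, Finset.sum_const, smul_eq_mul, mul_one, Finset.card_univ] at hdim
    obtain ⟨o, j, k, hoj, hok, hjk⟩ := Fintype.two_lt_card_iff.1 hdim
    refine ⟨fun i ↦ (if i = j then 1 else 0) + if i = k then -1 else 0, o, ?_, ?_⟩
    · simp [h1, Finset.sum_add_distrib, hoj, hok]
    · have : ∀ i, (m i : ℝ) * ((if i = j then 1 else 0) + if i = k then -1 else 0) ^ 2
          = (if i = j then 1 else 0) + if i = k then 1 else 0 := by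
        intro i
        by_cases h2 : i = j
        · subst h2; simp [hjk, h1]
        · simp [h2, h1]
      simp [this, Finset.sum_add_distrib, hoj, hok]

section ConformalClass

theorem self_mem_conformalClass {E : Type*} [NormedAddCommGroup E] [NormedSpace ℝ E]
    {H : Type*} [TopologicalSpace H] {I : ModelWithCorners ℝ E H}
    {M : Type*} [TopologicalSpace M] [ChartedSpace H M] [IsManifold I ∞ M] (h : SmoothMetric I M) :
    h ∈ conformalClass h :=
  ⟨fun _ ↦ 1, contMDiff_const, fun _ ↦ one_pos, fun _ _ _ ↦ by simp⟩

theorem conformalClass_subset_multiconformalClass {ι : Type*} [Fintype ι]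
    {E : ι → Type*} [∀ i, NormedAddCommGroup (E i)] [∀ i, NormedSpace ℝ (E i)]
    {H : ι → Type*} [∀ i, TopologicalSpace (H i)] {I : ∀ i, ModelWithCorners ℝ (E i) (H i)}
    {M : ι → Type*} [∀ i, TopologicalSpace (M i)] [∀ i, ChartedSpace (H i) (M i)]
    [∀ i, IsManifold (I i) ∞ (M i)] {g : ∀ i, SmoothMetric (I i) (M i)}
    {h : SmoothMetric (ModelWithCorners.pi I) (∀ i, M i)} (hh : h ∈ multiconformalClass g) :
    conformalClass h ⊆ multiconformalClass g := by
  rintro h' ⟨f, hf, hpos, hf'⟩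
  obtain ⟨F, hF, hFpos, hF'⟩ := hh
  refine ⟨fun i x ↦ f x * F i x, fun i ↦ hf.mul (hF i), fun i x ↦ mul_pos (hpos x) (hFpos i x),
    fun x v w ↦ ?_⟩
  rw [hf', hF', Finset.mul_sum]
  exact Finset.sum_congr rfl fun i _ ↦ by rw [mul_pow, mul_assoc]

end ConformalClass

end

theorem mainTheorem3 {l : ℕ} (hl : 2 ≤ l) (m : Fin l → ℕ) (hm : ∀ i, 1 ≤ m i)
    (hdim : 3 ≤ ∑ i, m i)
    (M : Fin l → Type*) [∀ i, TopologicalSpace (M i)]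
    [∀ i, ChartedSpace (EuclideanSpace ℝ (Fin (m i))) (M i)]
    [∀ i, IsManifold (𝓡 (m i)) ∞ (M i)]
    [∀ i, T2Space (M i)] [∀ i, SecondCountableTopology (M i)]
    [∀ i, CompactSpace (M i)] [∀ i, ConnectedSpace (M i)]
    [∀ i, MeasurableSpace (M i)] [∀ i, BorelSpace (M i)]
    (g : ∀ i, SmoothMetric (𝓡 (m i)) (M i)) :
    (⨅ (h : SmoothMetric (ModelWithCorners.pi fun i ↦ 𝓡 (m i)) (∀ i, M i))
        (_ : conformalClass h ⊆ multiconformalClass g), yamabeConstant h) =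
      (⨅ h ∈ multiconformalClass g, (einsteinHilbert h : EReal)) ∧
    (⨅ h ∈ multiconformalClass g, (einsteinHilbert h : EReal)) = ⊥ := by
  have hfin (i) : Module.finrank ℝ (EuclideanSpace ℝ (Fin (m i))) = m i := finrank_euclideanSpace_fin
  have hbot : (⨅ h ∈ multiconformalClass g, (einsteinHilbert h : EReal)) = ⊥ := by
    obtain ⟨β, o, hβ, hQ⟩ := exists_exponents m hm (by simpa using hl) hdim
    have : Nontrivial (EuclideanSpace ℝ (Fin (m o))) :=
      Module.nontrivial_of_finrank_pos (R := ℝ) (by rw [hfin]; exact hm o)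
    have hd : 2 ≤ Module.finrank ℝ (∀ i, EuclideanSpace ℝ (Fin (m i))) := by
      rw [Module.finrank_pi_fintype]
      simp only [hfin]
      omega
    refine EReal.eq_bot_iff_forall_lt _ |>.2 fun B ↦ ?_
    obtain ⟨h, hh, hB⟩ := exists_einsteinHilbert_le g (by simpa only [hfin] using hβ)
      (by simpa only [hfin] using hQ) hd (B - 1)
    refine (iInf₂_le h hh).trans_lt (EReal.coe_lt_coe_iff.2 ?_)
    linarith
  refine ⟨le_antisymm ?_ (hbot.trans_le bot_le), hbot⟩
  refine le_iInf₂ fun h hh ↦ (iInf₂_le h (conformalClass_subset_multiconformalClass hh)).trans ?_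
  exact iInf₂_le h (self_mem_conformalClass h)
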